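/- Let $H$ be a complex Hilbert space and $\Delta$ a positive (i.e. $\langle\Delta x,x\rangle\ge 0$ on the domain) self-adjoint, possibly unbounded, operator in $H$, and put $D=\Delta^{1/2}$. Then $\Delta$ has a spectral resolution $\Delta=\int_{[0,\infty)}\xi\,dE(\xi)$ with a projection-valued measure $E$. Write $\beta(\Delta)=\int\beta\,dE$ for bounded Borel functions $\beta$, and let $PW_\omega=PW_\omega(D)$ be the Paley–Wiener space of all $f\in H$ whose spectral transform with respect to $D$ is supported in $[0,\omega]$, i.e. $E(\{\xi\ge0:\sqrt\xi\le\omega\})f=f$. Let $\hat\phi,\hat\psi$ be Borel functions with $\operatorname{supp}\hat\phi\subseteq[0,1]$, $\operatorname{supp}\hat\psi\subseteq[1/4,4]$ and $$|\hat\phi(\xi)|^2+\sum_{j=0}^\infty|\hat\psi_j(\xi)|^2=1\quad(\xi>0),\qquad \hat\psi_j(\xi):=\hat\psi(2^{-2j}\xi);$$ if $\Delta$ is not injective, assume also $|\hat\phi(0)|=1$. Such pairs exist, with $|\hat\phi(0)|=1$, $\hat\phi,\hat\psi$ real-valued, and even $\operatorname{supp}\hat\psi\subseteq[1/2,2]$.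 Here the supports are understood as: the function vanishes outside the given closed interval. Put $S:=\hat\phi(\Delta)$ and $S_j:=\hat\psi_j(\Delta)$. These are bounded operators on $H$ with $S(H)\subseteq PW_1$ and $S_j(H)\subseteq PW_{2^{j+1}}$; $S$ is self-adjoint if $\hat\phi$ is real-valued, and all $S_j$ are self-adjoint if $\hat\psi$ is real-valued. For every $f\in H$, $$f=S^*Sf+\sum_{j=0}^\infty S_j^*S_jf ,$$ and, with the bandlimited vectors $g:=S^*f\in PW_1$ and $f_j:=S_j^*f\in PW_{2^{j+1}}$ (which are $Sf$ and $S_jf$ in the real-valued case), $$f=S(g)+\sum_{j=0}^\infty S_j(f_j),$$ both series converging unconditionally in the norm of $H$. -/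

import Mathlib

open MeasureTheory Set
open scoped ComplexConjugate ENNReal

/-- A projection-valued measure (resolution of the identity) on the Borel sets of `ℝ`, with values
in the orthogonal projections of the Hilbert space `H`.  The values of `proj` on non-Borel sets are
irrelevant and are never used. -/
structure ProjectionMeasure (H : Type*) [NormedAddCommGroup H] [InnerProductSpace ℂ H]
    [CompleteSpace H] where
  proj : Set ℝ → H →L[ℂ] H
  isStarProjection : ∀ A, MeasurableSet A → IsStarProjection (proj A)
  proj_univ : proj univ = 1
  hasSum_iUnion : ∀ A : ℕ → Set ℝ, (∀ n, MeasurableSet (A n)) →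
    Pairwise (Function.onFun Disjoint A) →
    ∀ x : H, HasSum (fun n => proj (A n) x) (proj (⋃ n, A n) x)

namespace ProjectionMeasure

variable {H : Type*} [NormedAddCommGroup H] [InnerProductSpace ℂ H] [CompleteSpace H]

theorem proj_empty (E : ProjectionMeasure H) (x : H) : E.proj ∅ x = 0 := by
  have h := E.hasSum_iUnion (fun _ => ∅) (fun _ => MeasurableSet.empty)
    (fun _ _ _ => by simp [Function.onFun]) x
  exact (summable_const_iff _).1 h.summable

theorem norm_sq_proj (E : ProjectionMeasure H) {A : Set ℝ} (hA : MeasurableSet A) (x : H) :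
    ‖E.proj A x‖ ^ 2 = (inner ℂ x (E.proj A x)).re := by
  have hp := E.isStarProjection A hA
  have h1 : E.proj A (E.proj A x) = E.proj A x :=
    congrArg (fun T : H →L[ℂ] H => T x) hp.isIdempotentElem
  have h2 : inner ℂ (E.proj A x) (E.proj A x) = inner ℂ x (E.proj A x) := by
    rw [← ContinuousLinearMap.adjoint_inner_right,
      ContinuousLinearMap.isSelfAdjoint_iff'.1 hp.isSelfAdjoint, h1]
  rw [← h2, inner_self_eq_norm_sq_to_K]
  norm_cast

/-- The scalar spectral measure of a vector `x`, that is `A ↦ ⟨E(A) x, x⟩ = ‖E(A) x‖²`. -/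
noncomputable def measure (E : ProjectionMeasure H) (x : H) : Measure ℝ :=
  Measure.ofMeasurable (fun A _ => ENNReal.ofReal (‖E.proj A x‖ ^ 2))
    (by simp [E.proj_empty x])
    (by
      intro A hA hd
      have h := E.hasSum_iUnion A hA hd x
      have h2 : HasSum (fun n => ‖E.proj (A n) x‖ ^ 2) (‖E.proj (⋃ n, A n) x‖ ^ 2) := by
        have h3 := ((innerSL ℂ x).hasSum h).mapL Complex.reCLM
        simp only [E.norm_sq_proj (hA _), E.norm_sq_proj (MeasurableSet.iUnion hA)]
        exact h3
      rw [← h2.tsum_eq]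
      exact ENNReal.ofReal_tsum_of_nonneg (fun n => by positivity) h2.summable)

theorem measure_apply (E : ProjectionMeasure H) (x : H) {A : Set ℝ} (hA : MeasurableSet A) :
    E.measure x A = ENNReal.ofReal (‖E.proj A x‖ ^ 2) :=
  Measure.ofMeasurable_apply A hA

/-- The image of a projection-valued measure under a Borel function `h`.  If `E` is the spectral
resolution of an operator `Δ`, then `E.map h` is the one of the operator `h(Δ) = ∫ h dE`. -/
def map (E : ProjectionMeasure H) (h : ℝ → ℝ) (hh : Measurable h) : ProjectionMeasure H where
  proj A := E.proj (h ⁻¹' A)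
  isStarProjection A hA := E.isStarProjection _ (hh hA)
  proj_univ := E.proj_univ
  hasSum_iUnion A hA hd x := by
    rw [preimage_iUnion]
    exact E.hasSum_iUnion _ (fun n => hh (hA n)) (fun i j hij => (hd hij).preimage h) x

/-- `E` is the spectral resolution of the positive operator `Δ`, that is `Δ = ∫_[0,∞) ξ dE(ξ)`:
`E` is carried by `[0, ∞)`, the domain of `Δ` consists of the `x` with
`∫ ξ² d⟨E(ξ) x, x⟩ < ∞`, and `⟨Δ x, x⟩ = ∫ ξ d⟨E(ξ) x, x⟩` on the domain
(by polarization this determines `⟨Δ x, y⟩`). -/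
structure IsSpectralResolutionOf (E : ProjectionMeasure H) (Δ : H →ₗ.[ℂ] H) : Prop where
  proj_neg : E.proj (Iio 0) = 0
  mem_domain_iff : ∀ x : H, x ∈ Δ.domain ↔ ∫⁻ ξ, ‖ξ‖ₑ ^ 2 ∂(E.measure x) < ∞
  inner_eq : ∀ x : Δ.domain, inner ℂ (x : H) (Δ x) = ∫ ξ, (ξ : ℂ) ∂(E.measure (x : H))

/-- `T` is the operator `β(Δ) = ∫ β(ξ) dE(ξ)`, for a bounded Borel function `β` and the spectral
resolution `E` of `Δ`: it is the bounded operator with `⟨T x, x⟩ = ∫ β(ξ) d⟨E(ξ) x, x⟩` for all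
`x` (which determines `T`, by polarization). -/
def IsMultiplier (E : ProjectionMeasure H) (β : ℝ → ℂ) (T : H →L[ℂ] H) : Prop :=
  ∀ x : H, inner ℂ x (T x) = ∫ ξ, β ξ ∂(E.measure x)

/-- The Paley-Wiener space `PW_ω(D)` of an operator `D ≥ 0` with spectral resolution `F`: the
vectors whose spectral transform with respect to `D` is supported in `[0, ω]`. -/
def paleyWiener (F : ProjectionMeasure H) (ω : ℝ) : Submodule ℂ H where
  carrier := {x | F.proj (Icc 0 ω) x = x}
  add_mem' {x y} hx hy := by
    simp only [mem_ofPred_eq, map_add] at *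
    rw [hx, hy]
  zero_mem' := by simp
  smul_mem' c x hx := by
    simp only [mem_ofPred_eq, map_smul] at *
    rw [hx]

/-- The space `PW_ω(D)` for `D = Δ^{1/2} = ∫ √ξ dE(ξ)`, where `E` is the spectral resolution
of `Δ`. -/
noncomputable def rootPaleyWiener (E : ProjectionMeasure H) (ω : ℝ) : Submodule ℂ H :=
  (E.map Real.sqrt Real.continuous_sqrt.measurable).paleyWiener ω

end ProjectionMeasure

/-- The `j`-th dyadic dilate `ψ_j(ξ) = ψ(2^{-2j} ξ)`. -/
noncomputable def dyadicDilate (ψ : ℝ → ℂ) (j : ℕ) (ξ : ℝ) : ℂ := ψ (ξ / 2 ^ (2 * j))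

/-- Borel functions `φ`, `ψ`, supported in `[0, 1]` and in the dyadic band
`[1/4, 4] = {ξ : 1/2 ≤ √ξ ≤ 2}`, which give the resolution of the identity
`|φ(ξ)|² + ∑_{j ≥ 0} |ψ(2^{-2j} ξ)|² = 1` for all `ξ > 0`. -/
structure IsCalderonPair (φ ψ : ℝ → ℂ) : Prop where
  measurable_low : Measurable φ
  measurable_band : Measurable ψ
  support_low : Function.support φ ⊆ Icc 0 1
  support_band : Function.support ψ ⊆ Icc (1 / 4) 4
  resolution : ∀ ξ : ℝ, 0 < ξ →
    HasSum (fun j : ℕ => ‖dyadicDilate ψ j ξ‖ ^ 2) (1 - ‖φ ξ‖ ^ 2)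

/-!
The operator part of the decomposition is the functional calculus `β ↦ β(Δ)` for bounded Borel
functions. It turns the pointwise identity `|φ|² + ∑ |ψ_j|² = 1`, which holds almost everywhere for
the spectral measures, into `S* S + ∑ S_j* S_j = 1`: the partial sums are bounded by `1`, and the
isometry `‖β(Δ) f‖² = ∫ |β|² d⟨E f, f⟩` with dominated convergence gives unconditional convergence
in norm (`SpectralCore.hasSum_op`). As the functions commute, the same computation gives
`S S* + ∑ S_j S_j* = 1`. The only place where the kernel of `Δ` matters is the point `0`, to which
the spectral measures of an injective `Δ` give no mass
(`ProjectionMeasure.measure_singleton_zero`).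

The calculus is built once, for a `SpectralCore`: a *-representation of an algebra of bounded
functions together with a measure `μ_x` for each vector `x` such that `⟨x, f(·) x⟩ = ∫ f dμ_x`. The
map `f ↦ f(·) x` is then isometric for the norm of `L²(μ_x)`, and as the algebra is dense there, it
extends to an isometry of `L²(μ_x)` into `H`. Approximating one function simultaneously in `L²` of
several of the measures shows that the extensions fit together to a *-representation of all
bounded measurable functions. There are two instances: the simple functions with a projection-valued
measure, which gives the calculus of a given resolution `E`, and the continuous functions on the
spectrum of a normal operator `R`, with the measures provided by the Riesz–Markov–Kakutani theorem.

The spectral theorem for `Δ` follows from the second instance with the resolvent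
`R = (1 + Δ)⁻¹`, which is a positive injective contraction. The spectral resolution of `Δ` is the
image of the one of `R` under `λ ↦ 1 / λ - 1`. That the domain of `Δ`, the range of `R`, consists of
the `x` for which this function is in `L²(μ_x)` is seen by applying the isometry of `L²(μ_x)`
to `1 / λ` (`SpectralCore.exists_apply_eq_of_lintegral_lt_top`).
-/

open Filter Topology ContinuousLinearMap

/-! ### The functional calculus generated by a dense algebra -/

theorem eLpNorm_two_sq {X : Type*} [MeasurableSpace X] (f : X → ℂ) (μ : Measure X) :
    eLpNorm f 2 μ ^ 2 = ∫⁻ t, ‖f t‖ₑ ^ 2 ∂μ := by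
  have h := eLpNorm_nnreal_pow_eq_lintegral (μ := μ) (f := f) (p := 2) (by norm_num)
  simpa using h

theorem tendsto_eLpNorm_mul_sub {X : Type*} [MeasurableSpace X] {μ : Measure X} {f β : X → ℂ}
    {F : ℕ → X → ℂ} (C : ℝ) (hf : ∀ t, ‖f t‖ ≤ C)
    (h : Tendsto (fun n => eLpNorm (F n - β) 2 μ) atTop (𝓝 0)) :
    Tendsto (fun n => eLpNorm (f * F n - f * β) 2 μ) atTop (𝓝 0) := by
  have h2 : Tendsto (fun n => ENNReal.ofReal C * eLpNorm (F n - β) 2 μ) atTop (𝓝 0) := by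
    simpa using ENNReal.Tendsto.const_mul h (Or.inr ENNReal.ofReal_ne_top)
  refine tendsto_of_tendsto_of_tendsto_of_le_of_le tendsto_const_nhds h2 (fun _ => zero_le)
    fun n => eLpNorm_le_mul_eLpNorm_of_ae_le_mul (ae_of_all _ fun t => ?_) 2
  have : (f * F n - f * β) t = f t * (F n - β) t := by simp [mul_sub]
  rw [this, norm_mul]
  gcongr
  exact hf t

theorem tendsto_eLpNorm_mono {X : Type*} [MeasurableSpace X] {μ ν : Measure X} (hμ : μ ≤ ν)
    {β : X → ℂ} {F : ℕ → X → ℂ} (h : Tendsto (fun n => eLpNorm (F n - β) 2 ν) atTop (𝓝 0)) :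
    Tendsto (fun n => eLpNorm (F n - β) 2 μ) atTop (𝓝 0) :=
  tendsto_of_tendsto_of_tendsto_of_le_of_le tendsto_const_nhds h (fun _ => zero_le)
    fun _ => eLpNorm_mono_measure _ hμ

theorem tendsto_eLpNorm_one_of_tendsto_eLpNorm_two {X : Type*} [MeasurableSpace X] {μ : Measure X}
    [IsFiniteMeasure μ] {F : ℕ → X → ℂ} (hF : ∀ n, AEStronglyMeasurable (F n) μ)
    (h : Tendsto (fun n => eLpNorm (F n) 2 μ) atTop (𝓝 0)) :
    Tendsto (fun n => eLpNorm (F n) 1 μ) atTop (𝓝 0) := by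
  set r : ℝ := 1 / (1 : ℝ≥0∞).toReal - 1 / (2 : ℝ≥0∞).toReal with hr
  have hr0 : 0 ≤ r := by norm_num [hr]
  have h2 : Tendsto (fun n => eLpNorm (F n) 2 μ * μ univ ^ r) atTop (𝓝 0) := by
    have := ENNReal.Tendsto.mul_const (b := μ univ ^ r) h
      (Or.inr (ENNReal.rpow_ne_top_of_nonneg hr0 (measure_ne_top _ _)))
    rwa [zero_mul] at this
  exact tendsto_of_tendsto_of_tendsto_of_le_of_le tendsto_const_nhds h2 (fun _ => zero_le)
    fun n => eLpNorm_le_eLpNorm_mul_rpow_measure_univ (by norm_num) (hF n)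

/-- Bounded measurable complex functions, the functions that a functional calculus accepts. -/
structure BddMeasurable {X : Type*} [MeasurableSpace X] (β : X → ℂ) : Prop where
  measurable : Measurable β
  bdd : ∃ C : ℝ, ∀ t, ‖β t‖ ≤ C

namespace BddMeasurable

variable {X : Type*} [MeasurableSpace X] {β γ : X → ℂ}

theorem memLp (h : BddMeasurable β) (μ : Measure X) [IsFiniteMeasure μ] : MemLp β 2 μ := by
  obtain ⟨C, hC⟩ := h.bdd
  exact MemLp.of_bound h.measurable.aestronglyMeasurable C (ae_of_all _ hC)

theorem integrable (h : BddMeasurable β) (μ : Measure X) [IsFiniteMeasure μ] : Integrable β μ :=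
  (h.memLp μ).integrable (by norm_num)

theorem mul (h : BddMeasurable β) (h' : BddMeasurable γ) : BddMeasurable (β * γ) := by
  obtain ⟨C, hC⟩ := h.bdd
  obtain ⟨D, hD⟩ := h'.bdd
  refine ⟨h.measurable.mul h'.measurable, C * D, fun t => ?_⟩
  rw [Pi.mul_apply, norm_mul]
  exact mul_le_mul (hC t) (hD t) (norm_nonneg _) ((norm_nonneg _).trans (hC t))

theorem add (h : BddMeasurable β) (h' : BddMeasurable γ) : BddMeasurable (β + γ) := by
  obtain ⟨C, hC⟩ := h.bdd
  obtain ⟨D, hD⟩ := h'.bdd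
  exact ⟨h.measurable.add h'.measurable, C + D, fun t => norm_add_le_of_le (hC t) (hD t)⟩

theorem star (h : BddMeasurable β) : BddMeasurable (star β) := by
  obtain ⟨C, hC⟩ := h.bdd
  exact ⟨Complex.continuous_conj.measurable.comp h.measurable, C, fun t => by simpa using hC t⟩

theorem smul (h : BddMeasurable β) (c : ℂ) : BddMeasurable (c • β) := by
  obtain ⟨C, hC⟩ := h.bdd
  refine ⟨h.measurable.const_smul c, ‖c‖ * C, fun t => ?_⟩
  rw [Pi.smul_apply, norm_smul]
  exact mul_le_mul_of_nonneg_left (hC t) (norm_nonneg _)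

theorem sub (h : BddMeasurable β) (h' : BddMeasurable γ) : BddMeasurable (β - γ) := by
  have := h.add (h'.smul (-1))
  rwa [neg_one_smul, ← sub_eq_add_neg] at this

theorem const (c : ℂ) : BddMeasurable (fun _ : X => c) :=
  ⟨measurable_const, ‖c‖, fun _ => le_rfl⟩

theorem one : BddMeasurable (1 : X → ℂ) := const 1

theorem indicator {A : Set X} (h : BddMeasurable β) (hA : MeasurableSet A) :
    BddMeasurable (A.indicator β) := by
  obtain ⟨C, hC⟩ := h.bdd
  exact ⟨h.measurable.indicator hA, C, fun t => (norm_indicator_le_norm_self _ _).trans (hC t)⟩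

theorem sum {ι : Type*} (s : Finset ι) {β : ι → X → ℂ} (h : ∀ i, BddMeasurable (β i)) :
    BddMeasurable (∑ i ∈ s, β i) := by
  classical
  induction s using Finset.induction_on with
  | empty => exact const (X := X) 0
  | insert i s hi ih => rw [Finset.sum_insert hi]; exact (h i).add ih

end BddMeasurable

/-- A *-representation of an algebra of bounded measurable functions on `X` in the Hilbert space
`H`, given by its graph (a function may a priori occur with several operators), with a scalar
spectral measure for every vector and with an algebra that is dense in `L²` of every finite
measure.  This is what the functional calculus for bounded measurable functions is built from. -/
structure SpectralCore (X H : Type*) [MeasurableSpace X] [NormedAddCommGroup H]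
    [InnerProductSpace ℂ H] [CompleteSpace H] where
  graph : Submodule ℂ ((X → ℂ) × (H →L[ℂ] H))
  measure : H → Measure X
  isFiniteMeasure : ∀ x, IsFiniteMeasure (measure x)
  one_mem : (1, 1) ∈ graph
  mul_mem : ∀ p ∈ graph, ∀ q ∈ graph, p * q ∈ graph
  star_mem : ∀ p ∈ graph, star p ∈ graph
  bddMeasurable : ∀ p ∈ graph, BddMeasurable p.1
  inner_eq : ∀ p ∈ graph, ∀ x : H, inner ℂ x (p.2 x) = ∫ t, p.1 t ∂(measure x)
  dense : ∀ (ν : Measure X) [IsFiniteMeasure ν] (β : X → ℂ), MemLp β 2 ν → ∀ ε : ℝ≥0∞, ε ≠ 0 →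
    ∃ p ∈ graph, eLpNorm (p.1 - β) 2 ν ≤ ε

namespace SpectralCore

variable {X H : Type*} [MeasurableSpace X] [NormedAddCommGroup H] [InnerProductSpace ℂ H]
  [CompleteSpace H] (C : SpectralCore X H)

attribute [instance] SpectralCore.isFiniteMeasure

/-- The isometry on which everything rests: apply the form identity to `f̄ f` and `T* T`. -/
theorem enorm_apply {p : (X → ℂ) × (H →L[ℂ] H)} (hp : p ∈ C.graph) (x : H) :
    ‖p.2 x‖ₑ = eLpNorm p.1 2 (C.measure x) := by
  have h1 := C.inner_eq _ (C.mul_mem _ (C.star_mem _ hp) _ hp) x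
  have h2 : inner ℂ x ((star p * p).2 x) = ((‖p.2 x‖ ^ 2 : ℝ) : ℂ) := by
    change inner ℂ x (adjoint p.2 (p.2 x)) = _
    rw [adjoint_inner_right, inner_self_eq_norm_sq_to_K]
    norm_cast
  have h3 : ∀ t, (star p * p).1 t = ((‖p.1 t‖ ^ 2 : ℝ) : ℂ) := fun t => by
    change conj (p.1 t) * p.1 t = _
    rw [Complex.conj_mul']
    norm_cast
  simp only [h2, h3] at h1
  rw [integral_complex_ofReal, Complex.ofReal_inj] at h1
  have hint : Integrable (fun t => ‖p.1 t‖ ^ 2) (C.measure x) :=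
    ((C.bddMeasurable p hp).memLp _).integrable_norm_pow (by norm_num)
  have h4 : ‖p.2 x‖ₑ ^ 2 = eLpNorm p.1 2 (C.measure x) ^ 2 := by
    rw [eLpNorm_two_sq, ← ofReal_norm, ← ENNReal.ofReal_pow (norm_nonneg _), h1,
      ofReal_integral_eq_lintegral_ofReal hint (ae_of_all _ fun t => by positivity)]
    refine lintegral_congr fun t => ?_
    rw [← ofReal_norm, ENNReal.ofReal_pow (norm_nonneg _)]
  exact (ENNReal.pow_right_strictMono two_ne_zero).injective h4

theorem exists_approx (ν : Measure X) [IsFiniteMeasure ν] {β : X → ℂ} (hβ : MemLp β 2 ν) :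
    ∃ p : ℕ → (X → ℂ) × (H →L[ℂ] H), (∀ n, p n ∈ C.graph) ∧
      Tendsto (fun n => eLpNorm ((p n).1 - β) 2 ν) atTop (𝓝 0) := by
  obtain ⟨u, -, hu, hu0⟩ := exists_seq_strictAnti_tendsto' (show (0 : ℝ≥0∞) < 1 by simp)
  choose p hp hpu using fun n => C.dense ν β hβ (u n) (hu n).1.ne'
  exact ⟨p, hp, tendsto_of_tendsto_of_tendsto_of_le_of_le tendsto_const_nhds hu0
    (fun _ => zero_le) hpu⟩

/-- `v` is the vector `∫ β dE x`, for `β` in `L²` of the spectral measure of `x`: the image of `β`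
under the isometry of that `L²` space into `H` which extends `f ↦ f(·) x`. -/
def Represents (x : H) (β : X → ℂ) (v : H) : Prop :=
  ∀ p ∈ C.graph, ‖p.2 x - v‖ₑ = eLpNorm (p.1 - β) 2 (C.measure x)

variable {C} {x y v w : H} {β γ : X → ℂ}

theorem Represents.tendsto (h : C.Represents x β v) {p : ℕ → (X → ℂ) × (H →L[ℂ] H)}
    (hp : ∀ n, p n ∈ C.graph)
    (hlim : Tendsto (fun n => eLpNorm ((p n).1 - β) 2 (C.measure x)) atTop (𝓝 0)) :
    Tendsto (fun n => (p n).2 x) atTop (𝓝 v) := by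
  rw [tendsto_iff_edist_tendsto_0]
  refine hlim.congr fun n => ?_
  rw [edist_eq_enorm_sub, h _ (hp n)]

/-- A limit along one approximating sequence already represents `β`, the distances to all the other
vectors `T x` being given by the isometry. -/
theorem represents_of_tendsto (hβ : MemLp β 2 (C.measure x)) {p : ℕ → (X → ℂ) × (H →L[ℂ] H)}
    (hp : ∀ n, p n ∈ C.graph)
    (hlim : Tendsto (fun n => eLpNorm ((p n).1 - β) 2 (C.measure x)) atTop (𝓝 0))
    (hv : Tendsto (fun n => (p n).2 x) atTop (𝓝 v)) : C.Represents x β v := by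
  intro q hq
  have h1 : Tendsto (fun n => ‖q.2 x - (p n).2 x‖ₑ) atTop (𝓝 ‖q.2 x - v‖ₑ) :=
    (tendsto_const_nhds.sub hv).enorm
  have h2 : ∀ n, ‖q.2 x - (p n).2 x‖ₑ = eLpNorm (q.1 - (p n).1) 2 (C.measure x) := fun n =>
    C.enorm_apply (C.graph.sub_mem hq (hp n)) x
  simp only [h2] at h1
  refine tendsto_nhds_unique h1 ?_
  have hqm := (C.bddMeasurable q hq).memLp (C.measure x)
  have hpm n := (C.bddMeasurable _ (hp n)).memLp (C.measure x)
  set a := eLpNorm (q.1 - β) 2 (C.measure x)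
  have hup n : eLpNorm (q.1 - (p n).1) 2 (C.measure x) ≤
      a + eLpNorm ((p n).1 - β) 2 (C.measure x) := by
    rw [show q.1 - (p n).1 = (q.1 - β) - ((p n).1 - β) by abel]
    exact eLpNorm_sub_le (hqm.sub hβ).1 ((hpm n).sub hβ).1 (by norm_num)
  have hlo n : a - eLpNorm ((p n).1 - β) 2 (C.measure x) ≤
      eLpNorm (q.1 - (p n).1) 2 (C.measure x) := by
    rw [tsub_le_iff_right]
    change eLpNorm (q.1 - β) 2 (C.measure x) ≤ _
    rw [show q.1 - β = (q.1 - (p n).1) + ((p n).1 - β) by abel]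
    exact eLpNorm_add_le (hqm.sub (hpm n)).1 ((hpm n).sub hβ).1 (by norm_num)
  have ha : a ≠ ∞ := (hqm.sub hβ).eLpNorm_ne_top
  refine tendsto_of_tendsto_of_tendsto_of_le_of_le ?_ ?_ hlo hup
  · simpa using ENNReal.Tendsto.sub (tendsto_const_nhds (x := a)) hlim (Or.inl ha)
  · simpa using (tendsto_const_nhds (x := a)).add hlim

theorem exists_represents (hβ : MemLp β 2 (C.measure x)) : ∃ v, C.Represents x β v := by
  obtain ⟨p, hp, hlim⟩ := C.exists_approx _ hβ
  have hpm n := (C.bddMeasurable _ (hp n)).memLp (C.measure x)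
  have hc : CauchySeq fun n => (p n).2 x := by
    rw [EMetric.cauchySeq_iff]
    intro ε hε
    have hε2 : 0 < ε / 2 := ENNReal.half_pos hε.ne'
    obtain ⟨N, hN⟩ := (hlim.eventually (gt_mem_nhds hε2)).exists_forall_of_atTop
    refine ⟨N, fun m hm n hn => ?_⟩
    rw [edist_eq_enorm_sub]
    refine (C.enorm_apply (C.graph.sub_mem (hp m) (hp n)) x).trans_lt ?_
    change eLpNorm ((p m).1 - (p n).1) 2 (C.measure x) < ε
    rw [show (p m).1 - (p n).1 = ((p m).1 - β) - ((p n).1 - β) by abel]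
    calc _ ≤ _ := eLpNorm_sub_le ((hpm m).sub hβ).1 ((hpm n).sub hβ).1 (by norm_num)
      _ < ε / 2 + ε / 2 := ENNReal.add_lt_add (hN m hm) (hN n hn)
      _ = ε := ENNReal.add_halves ε
  obtain ⟨v, hv⟩ := cauchySeq_tendsto_of_complete hc
  exact ⟨v, represents_of_tendsto hβ hp hlim hv⟩

theorem Represents.unique (hβ : MemLp β 2 (C.measure x)) (h : C.Represents x β v)
    (h' : C.Represents x β w) : v = w := by
  obtain ⟨p, hp, hlim⟩ := C.exists_approx _ hβ
  exact tendsto_nhds_unique (h.tendsto hp hlim) (h'.tendsto hp hlim)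

theorem Represents.congr_ae (h : C.Represents x β v) (hβγ : β =ᵐ[C.measure x] γ) :
    C.Represents x γ v := fun p hp => by
  rw [h p hp]
  refine eLpNorm_congr_ae ?_
  filter_upwards [hβγ] with t ht
  simp [ht]

theorem Represents.enorm_eq (h : C.Represents x β v) : ‖v‖ₑ = eLpNorm β 2 (C.measure x) := by
  have := h 0 C.graph.zero_mem
  simpa using this

theorem Represents.apply_of_mem (h : C.Represents x β v) (hβ : MemLp β 2 (C.measure x))
    {p : (X → ℂ) × (H →L[ℂ] H)} (hp : p ∈ C.graph) : C.Represents x (p.1 * β) (p.2 v) := by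
  obtain ⟨q, hq, hlim⟩ := C.exists_approx _ hβ
  obtain ⟨D, hD⟩ := (C.bddMeasurable p hp).bdd
  have hmem : MemLp (p.1 * β) 2 (C.measure x) := by
    refine hβ.of_le_mul (c := D)
      ((C.bddMeasurable p hp).measurable.aestronglyMeasurable.mul hβ.1) (ae_of_all _ fun t => ?_)
    rw [Pi.mul_apply, norm_mul]
    gcongr
    exact hD t
  refine represents_of_tendsto hmem (fun n => C.mul_mem p hp _ (hq n))
    (tendsto_eLpNorm_mul_sub D hD hlim) ?_
  exact (p.2.continuous.tendsto v).comp (h.tendsto hq hlim)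

theorem represents_of_mem {p : (X → ℂ) × (H →L[ℂ] H)} (hp : p ∈ C.graph) (x : H) :
    C.Represents x p.1 (p.2 x) := fun _ hq => C.enorm_apply (C.graph.sub_mem hq hp) x

theorem eLpNorm_one_measure (C : SpectralCore X H) (x : H) :
    eLpNorm (1 : X → ℂ) 2 (C.measure x) = ‖x‖ₑ :=
  (C.enorm_apply C.one_mem x).symm

/-- One sequence that approximates `β` for the sum of the three spectral measures serves all three
vectors at once; this is how operators are obtained from the vectorwise isometries. -/
theorem Represents.add (hβ : BddMeasurable β) {u : H} (hv : C.Represents x β v)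
    (hw : C.Represents y β w) (hu : C.Represents (x + y) β u) : u = v + w := by
  obtain ⟨p, hp, hlim⟩ :=
    C.exists_approx _ (hβ.memLp (C.measure x + C.measure y + C.measure (x + y)))
  have h1 := hv.tendsto hp (tendsto_eLpNorm_mono
    (Measure.le_add_right (Measure.le_add_right le_rfl)) hlim)
  have h2 := hw.tendsto hp (tendsto_eLpNorm_mono
    (Measure.le_add_right (Measure.le_add_left le_rfl)) hlim)
  have h3 := hu.tendsto hp (tendsto_eLpNorm_mono (Measure.le_add_left le_rfl) hlim)
  refine tendsto_nhds_unique h3 ((h1.add h2).congr fun n => ?_)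
  simp

theorem Represents.smul (hβ : BddMeasurable β) {c : ℂ} (hv : C.Represents x β v)
    (hw : C.Represents (c • x) β w) : w = c • v := by
  obtain ⟨p, hp, hlim⟩ := C.exists_approx _ (hβ.memLp (C.measure x + C.measure (c • x)))
  have h1 := hv.tendsto hp (tendsto_eLpNorm_mono (Measure.le_add_right le_rfl) hlim)
  have h2 := hw.tendsto hp (tendsto_eLpNorm_mono (Measure.le_add_left le_rfl) hlim)
  refine tendsto_nhds_unique h2 ((h1.const_smul c).congr fun n => ?_)
  simp

variable (C)

theorem exists_op (hβ : BddMeasurable β) :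
    ∃ T : H →L[ℂ] H, ∀ x, C.Represents x β (T x) := by
  choose T hT using fun x => exists_represents (C := C) (x := x) (hβ.memLp _)
  obtain ⟨D, hD⟩ := hβ.bdd
  refine ⟨LinearMap.mkContinuous
    { toFun := T
      map_add' := fun x y => (hT x).add hβ (hT y) (hT _)
      map_smul' := fun c x => (hT x).smul hβ (hT _) } (max D 0) fun x => ?_, hT⟩
  have h : ‖T x‖ₑ ≤ ENNReal.ofReal (max D 0) * ‖x‖ₑ := by
    rw [(hT x).enorm_eq, ← C.eLpNorm_one_measure x]
    refine eLpNorm_le_mul_eLpNorm_of_ae_le_mul (ae_of_all _ fun t => ?_) 2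
    simpa using Or.inl (hD t)
  rw [← ofReal_norm, ← ofReal_norm, ← ENNReal.ofReal_mul (le_max_right _ _)] at h
  exact (ENNReal.ofReal_le_ofReal_iff (by positivity)).1 h

open Classical in
/-- The operator `∫ β dE` for a bounded measurable function `β`, and `0` for other functions. -/
noncomputable def op (β : X → ℂ) : H →L[ℂ] H :=
  if h : ∃ T : H →L[ℂ] H, ∀ x, C.Represents x β (T x) then h.choose else 0

theorem op_represents (hβ : BddMeasurable β) (x : H) : C.Represents x β (C.op β x) := by
  have h := C.exists_op hβ
  rw [op, dif_pos h]
  exact h.choose_spec x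

theorem enorm_op (hβ : BddMeasurable β) (x : H) :
    ‖C.op β x‖ₑ = eLpNorm β 2 (C.measure x) := (C.op_represents hβ x).enorm_eq

theorem op_eq_of_mem {p : (X → ℂ) × (H →L[ℂ] H)} (hp : p ∈ C.graph) : C.op p.1 = p.2 := by
  ext x
  have hβ := C.bddMeasurable p hp
  exact (C.op_represents hβ x).unique (hβ.memLp _) (represents_of_mem hp x)

theorem op_one : C.op 1 = 1 := C.op_eq_of_mem (p := (1, 1)) C.one_mem

theorem op_zero : C.op 0 = 0 := C.op_eq_of_mem (p := 0) C.graph.zero_mem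

theorem inner_op (hβ : BddMeasurable β) (x : H) :
    inner ℂ x (C.op β x) = ∫ t, β t ∂(C.measure x) := by
  obtain ⟨p, hp, hlim⟩ := C.exists_approx _ (hβ.memLp (C.measure x))
  have h1 := (tendsto_const_nhds (x := x)).inner (𝕜 := ℂ) ((C.op_represents hβ x).tendsto hp hlim)
  refine tendsto_nhds_unique (h1.congr fun n => C.inner_eq _ (hp n) x) ?_
  refine tendsto_integral_of_L1' _ (hβ.integrable _).1
    (Eventually.of_forall fun n => (C.bddMeasurable _ (hp n)).integrable _) ?_
  exact tendsto_eLpNorm_one_of_tendsto_eLpNorm_two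
    (fun n => ((C.bddMeasurable _ (hp n)).sub hβ).measurable.aestronglyMeasurable) hlim

theorem op_sub (hβ : BddMeasurable β) (hγ : BddMeasurable γ) :
    C.op (β - γ) = C.op β - C.op γ := by
  ext x
  obtain ⟨p, hp, hlim⟩ := C.exists_approx _ (hβ.memLp (C.measure x))
  obtain ⟨q, hq, hlim'⟩ := C.exists_approx _ (hγ.memLp (C.measure x))
  have h1 := (C.op_represents hβ x).tendsto hp hlim
  have h2 := (C.op_represents hγ x).tendsto hq hlim'
  have h3 : Tendsto (fun n => eLpNorm ((p n - q n).1 - (β - γ)) 2 (C.measure x)) atTop (𝓝 0) := by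
    refine tendsto_of_tendsto_of_tendsto_of_le_of_le tendsto_const_nhds
      (by simpa using hlim.add hlim') (fun _ => zero_le) fun n => ?_
    change eLpNorm ((p n).1 - (q n).1 - (β - γ)) 2 (C.measure x) ≤ _
    rw [sub_sub_sub_comm]
    exact eLpNorm_sub_le ((C.bddMeasurable _ (hp n)).sub hβ).measurable.aestronglyMeasurable
      ((C.bddMeasurable _ (hq n)).sub hγ).measurable.aestronglyMeasurable (by norm_num)
  exact tendsto_nhds_unique ((C.op_represents (hβ.sub hγ) x).tendsto
    (fun n => C.graph.sub_mem (hp n) (hq n)) h3) (h1.sub h2)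

/-- Multiplicativity is inherited first in the left factor: `β` is approximated at once for the
spectral measures of `x` and of `z = op γ x`, and multiplication by the bounded `γ` preserves the
approximation. -/
theorem op_mul (hβ : BddMeasurable β) (hγ : BddMeasurable γ) :
    C.op (β * γ) = C.op β * C.op γ := by
  ext x
  set z := C.op γ x
  obtain ⟨p, hp, hlim⟩ := C.exists_approx _ (hβ.memLp (C.measure x + C.measure z))
  have h1 : Tendsto (fun n => (p n).2 z) atTop (𝓝 (C.op β z)) :=
    (C.op_represents hβ z).tendsto hp (tendsto_eLpNorm_mono (Measure.le_add_left le_rfl) hlim)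
  obtain ⟨D, hD⟩ := hγ.bdd
  have h2 : Tendsto (fun n => eLpNorm (γ * (p n).1 - γ * β) 2 (C.measure x)) atTop (𝓝 0) :=
    tendsto_eLpNorm_mul_sub D hD (tendsto_eLpNorm_mono (Measure.le_add_right le_rfl) hlim)
  have h3 n : (p n).2 z = C.op ((p n).1 * γ) x :=
    ((C.op_represents hγ x).apply_of_mem (hγ.memLp _) (hp n)).unique
      (((C.bddMeasurable _ (hp n)).mul hγ).memLp _) (C.op_represents
        ((C.bddMeasurable _ (hp n)).mul hγ) x)
  have h4 : Tendsto (fun n => (p n).2 z) atTop (𝓝 (C.op (β * γ) x)) := by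
    rw [tendsto_iff_edist_tendsto_0]
    refine h2.congr fun n => ?_
    have hm := (C.bddMeasurable _ (hp n)).mul hγ
    rw [h3, edist_eq_enorm_sub, ← sub_apply, ← C.op_sub hm (hβ.mul hγ),
      C.enorm_op (hm.sub (hβ.mul hγ)), mul_comm γ, mul_comm γ]
  exact tendsto_nhds_unique h4 h1

theorem op_star (hβ : BddMeasurable β) : C.op (star β) = adjoint (C.op β) := by
  rw [eq_adjoint_iff]
  intro x y
  obtain ⟨p, hp, hlim⟩ := C.exists_approx _ (hβ.memLp (C.measure x + C.measure y))
  have h1 := (C.op_represents hβ y).tendsto hp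
    (tendsto_eLpNorm_mono (Measure.le_add_left le_rfl) hlim)
  have h2 : Tendsto (fun n => (star (p n)).2 x) atTop (𝓝 (C.op (star β) x)) := by
    refine (C.op_represents hβ.star x).tendsto (fun n => C.star_mem _ (hp n)) ?_
    refine (tendsto_eLpNorm_mono (Measure.le_add_right le_rfl) hlim).congr fun n => ?_
    refine eLpNorm_congr_norm_ae (ae_of_all _ fun t => ?_)
    change _ = ‖star ((p n).1 t) - star (β t)‖
    rw [← star_sub, norm_star]
    rfl
  refine tendsto_nhds_unique (h2.inner tendsto_const_nhds)
    ((tendsto_const_nhds.inner h1).congr fun n => ?_)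
  exact (adjoint_inner_left _ _ _).symm

/-- Unconditional convergence of a series of operators on a vector `x`, from pointwise convergence
of the functions and a uniform bound for the partial sums, by dominated convergence along the
finite sets of indices. -/
theorem hasSum_op {β : X → ℂ} {b : ℕ → X → ℂ} (hβ : BddMeasurable β)
    (hb : ∀ n, BddMeasurable (b n)) {D : ℝ}
    (hD : ∀ᵐ t ∂(C.measure x), ∀ s : Finset ℕ, ‖β t - ∑ n ∈ s, b n t‖ ≤ D)
    (hsum : ∀ᵐ t ∂(C.measure x), HasSum (fun n => b n t) (β t)) :
    HasSum (fun n => C.op (b n) x) (C.op β x) := by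
  have hop (s : Finset ℕ) : C.op (∑ n ∈ s, b n) x = ∑ n ∈ s, C.op (b n) x := by
    classical
    induction s using Finset.induction_on with
    | empty => simp [C.op_zero]
    | insert i s hi ih =>
      rw [Finset.sum_insert hi, Finset.sum_insert hi, ← ih]
      have h := C.op_sub ((hb i).add (BddMeasurable.sum s hb)) (hb i)
      rw [add_sub_cancel_left] at h
      rw [h, sub_apply, add_sub_cancel]
  rw [HasSum, SummationFilter.unconditional_filter, tendsto_iff_edist_tendsto_0]
  have hlim : Tendsto (fun s : Finset ℕ => ∫⁻ t, ‖β t - ∑ n ∈ s, b n t‖ₑ ^ 2 ∂(C.measure x)) atTop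
      (𝓝 (∫⁻ _, 0 ∂(C.measure x))) := by
    refine tendsto_lintegral_filter_of_dominated_convergence (fun _ => ENNReal.ofReal D ^ 2)
      (Eventually.of_forall fun s => ?_) (Eventually.of_forall fun s => ?_) ?_ ?_
    · have := (hβ.sub (BddMeasurable.sum s hb)).measurable.enorm.pow_const 2
      simpa using this
    · filter_upwards [hD] with t ht
      rw [← ofReal_norm]
      gcongr
      exact ht s
    · simp [ENNReal.mul_eq_top]
    · filter_upwards [hsum] with t ht
      have h : Tendsto (fun s : Finset ℕ => ‖β t - ∑ n ∈ s, b n t‖ₑ ^ 2) atTop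
          (𝓝 (‖β t - β t‖ₑ ^ 2)) :=
        ((ENNReal.continuous_pow 2).tendsto _).comp (tendsto_const_nhds.sub ht).enorm
      simpa using h
  have hlim2 : Tendsto (fun s : Finset ℕ => ‖C.op β x - ∑ n ∈ s, C.op (b n) x‖ₑ ^ 2) atTop
      (𝓝 0) := by
    rw [lintegral_zero] at hlim
    refine hlim.congr fun s => ?_
    rw [← hop, ← sub_apply, ← C.op_sub hβ (BddMeasurable.sum s hb),
      C.enorm_op (hβ.sub (BddMeasurable.sum s hb)), eLpNorm_two_sq]
    simp
  have hlim3 := ((ENNReal.continuous_rpow_const (y := 1 / 2)).tendsto _).comp hlim2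
  simp only [one_div] at hlim3
  rw [ENNReal.zero_rpow_of_pos (by norm_num)] at hlim3
  refine hlim3.congr fun s => ?_
  rw [edist_comm, edist_eq_enorm_sub, Function.comp, ← ENNReal.rpow_natCast, ← ENNReal.rpow_mul]
  norm_num

theorem measure_apply {A : Set X} (hA : MeasurableSet A) (x : H) :
    C.measure x A = ‖C.op (A.indicator 1) x‖ₑ ^ 2 := by
  rw [C.enorm_op (BddMeasurable.one.indicator hA), eLpNorm_two_sq]
  have h : ∀ t, ‖A.indicator (1 : X → ℂ) t‖ₑ ^ 2 = A.indicator 1 t := fun t => by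
    by_cases ht : t ∈ A <;> simp [ht]
  simp only [h]
  rw [lintegral_indicator_one hA]

/-- The spectral measure of `∫ β dE x` has density `|β|²` with respect to the one of `x`. -/
theorem measure_op (hβ : BddMeasurable β) (x : H) :
    C.measure (C.op β x) = (C.measure x).withDensity fun t => ‖β t‖ₑ ^ 2 := by
  ext A hA
  have h1 : BddMeasurable (A.indicator (1 : X → ℂ)) :=
    BddMeasurable.one.indicator hA
  have h2 : C.op (A.indicator 1) (C.op β x) = C.op (A.indicator 1 * β) x := by
    rw [C.op_mul h1 hβ]
    rfl
  rw [C.measure_apply hA, withDensity_apply _ hA, h2, C.enorm_op (h1.mul hβ),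
    eLpNorm_two_sq, ← lintegral_indicator hA]
  refine lintegral_congr fun t => ?_
  by_cases ht : t ∈ A <;> simp [ht]

end SpectralCore

/-! ### Projection-valued measures and the functional calculus -/

namespace ProjectionMeasure

variable {H : Type*} [NormedAddCommGroup H] [InnerProductSpace ℂ H] [CompleteSpace H]
  (E : ProjectionMeasure H)

theorem proj_union {A B : Set ℝ} (hA : MeasurableSet A) (hB : MeasurableSet B)
    (hd : Disjoint A B) : E.proj (A ∪ B) = E.proj A + E.proj B := by
  ext x
  let F : ℕ → Set ℝ := fun n => if n = 0 then A else if n = 1 then B else ∅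
  have hF : ⋃ n, F n = A ∪ B := by
    ext t
    simp only [mem_iUnion, mem_union]
    constructor
    · rintro ⟨n, hn⟩
      by_cases h0 : n = 0
      · exact Or.inl (by simpa [F, h0] using hn)
      · by_cases h1 : n = 1
        · exact Or.inr (by simpa [F, h1] using hn)
        · simp [F, h0, h1] at hn
    · rintro (h | h)
      · exact ⟨0, by simpa [F] using h⟩
      · exact ⟨1, by simpa [F] using h⟩
  have h := E.hasSum_iUnion F (fun n => by dsimp only [F]; split_ifs <;> simp [*])
    (fun i j hij => by
      simp only [Function.onFun, F]
      split_ifs <;> first | omega | exact hd | exact hd.symm | simp) x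
  rw [hF] at h
  have h2 : HasSum (fun n => E.proj (F n) x) (∑ n ∈ Finset.range 2, E.proj (F n) x) := by
    refine hasSum_sum_of_ne_finset_zero fun n hn => ?_
    have h0 : n ≠ 0 := by rintro rfl; simp at hn
    have h1 : n ≠ 1 := by rintro rfl; simp at hn
    simp [F, h0, h1, E.proj_empty]
  rw [h.unique h2, Finset.sum_range_succ, Finset.sum_range_one]
  simp [F]

theorem proj_mul_proj_of_disjoint {A B : Set ℝ} (hA : MeasurableSet A) (hB : MeasurableSet B)
    (hd : Disjoint A B) : E.proj A * E.proj B = 0 := by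
  -- two projections whose sum is a projection anticommute, hence are orthogonal
  have hP := (E.isStarProjection A hA).isIdempotentElem
  have hQ := (E.isStarProjection B hB).isIdempotentElem
  have hPQ := (E.isStarProjection _ (hA.union hB)).isIdempotentElem
  rw [E.proj_union hA hB hd, hP.add_iff hQ] at hPQ
  have := IsAddTorsionFree.of_isTorsionFree ℂ (H →L[ℂ] H)
  exact hP.mul_eq_zero_of_anticommute hPQ

theorem proj_mul_proj {A B : Set ℝ} (hA : MeasurableSet A) (hB : MeasurableSet B) :
    E.proj A * E.proj B = E.proj (A ∩ B) := by
  have hAB := hA.inter hB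
  have h1 : E.proj A = E.proj (A ∩ B) + E.proj (A \ B) := by
    rw [← E.proj_union hAB (hA.diff hB) (disjoint_sdiff_inter.symm), inter_union_sdiff]
  have h2 : E.proj B = E.proj (A ∩ B) + E.proj (B \ A) := by
    rw [inter_comm, ← E.proj_union (hB.inter hA) (hB.diff hA) (disjoint_sdiff_inter.symm),
      inter_union_sdiff]
  rw [h1, h2, add_mul, mul_add, mul_add,
    E.proj_mul_proj_of_disjoint hAB (hB.diff hA)
      (disjoint_sdiff_right.mono_left inter_subset_left),
    E.proj_mul_proj_of_disjoint (hA.diff hB) hAB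
      (disjoint_sdiff_left.mono_right inter_subset_right),
    E.proj_mul_proj_of_disjoint (hA.diff hB) (hB.diff hA)
      (disjoint_sdiff_left.mono_right sdiff_subset),
    (E.isStarProjection _ hAB).isIdempotentElem.eq]
  simp

theorem measure_univ (x : H) : E.measure x univ = ENNReal.ofReal (‖x‖ ^ 2) := by
  rw [E.measure_apply x MeasurableSet.univ, E.proj_univ]
  rfl

instance (x : H) : IsFiniteMeasure (E.measure x) :=
  ⟨by rw [E.measure_univ]; exact ENNReal.ofReal_lt_top⟩

/-- The indicator functions of Borel sets, paired with the values of `E`. -/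
def indicatorGraph : Set ((ℝ → ℂ) × (H →L[ℂ] H)) :=
  {p | ∃ A, MeasurableSet A ∧ p = (A.indicator 1, E.proj A)}

/-- The form identity is linear in the pair, and for a projection it is the definition of the scalar
spectral measure. -/
theorem span_indicatorGraph_spec {p : (ℝ → ℂ) × (H →L[ℂ] H)}
    (hp : p ∈ Submodule.span ℂ E.indicatorGraph) :
    BddMeasurable p.1 ∧ ∀ x : H, inner ℂ x (p.2 x) = ∫ t, p.1 t ∂(E.measure x) := by
  induction hp using Submodule.span_induction with
  | mem p hp =>
    obtain ⟨A, hA, rfl⟩ := hp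
    refine ⟨BddMeasurable.one.indicator hA, fun x => ?_⟩
    have h1 : inner ℂ x (E.proj A x) = ((‖E.proj A x‖ ^ 2 : ℝ) : ℂ) := by
      have hp := E.isStarProjection A hA
      have h2 : E.proj A (E.proj A x) = E.proj A x :=
        congrArg (fun T : H →L[ℂ] H => T x) hp.isIdempotentElem
      have h3 : inner ℂ (E.proj A x) (E.proj A x) = inner ℂ x (E.proj A x) := by
        rw [← adjoint_inner_right, isSelfAdjoint_iff'.1 hp.isSelfAdjoint, h2]
      rw [← h3, inner_self_eq_norm_sq_to_K]
      norm_cast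
    simp only [h1]
    rw [integral_indicator hA]
    simp [measureReal_def, E.measure_apply x hA]
  | zero => exact ⟨BddMeasurable.const 0, fun x => by simp⟩
  | add p q _ _ hp hq =>
    refine ⟨hp.1.add hq.1, fun x => ?_⟩
    simp only [Prod.fst_add, Prod.snd_add, Pi.add_apply, add_apply, inner_add_right, hp.2, hq.2]
    rw [integral_add (hp.1.integrable _) (hq.1.integrable _)]
  | smul c p _ hp =>
    refine ⟨hp.1.smul c, fun x => ?_⟩
    simp only [Prod.smul_fst, Prod.smul_snd, Pi.smul_apply, smul_apply, inner_smul_right, hp.2,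
      smul_eq_mul]
    rw [integral_const_mul]

theorem exists_mem_span_indicatorGraph (g : SimpleFunc ℝ ℂ) :
    ∃ p ∈ Submodule.span ℂ E.indicatorGraph, p.1 = g := by
  induction g using SimpleFunc.induction with
  | const c hs =>
    rename_i s
    refine ⟨c • (s.indicator 1, E.proj s),
      Submodule.smul_mem _ _ (Submodule.subset_span ⟨s, hs, rfl⟩), ?_⟩
    ext t
    by_cases ht : t ∈ s <;> simp [ht]
  | add _ hf hg =>
    obtain ⟨p, hp, hpf⟩ := hf
    obtain ⟨q, hq, hqg⟩ := hg
    exact ⟨p + q, Submodule.add_mem _ hp hq, by rw [Prod.fst_add, hpf, hqg]; rfl⟩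

/-- The *-representation of the simple functions on `ℝ` given by a projection-valued measure. -/
noncomputable def spectralCore : SpectralCore ℝ H where
  graph := Submodule.span ℂ E.indicatorGraph
  measure := E.measure
  isFiniteMeasure _ := inferInstance
  one_mem := Submodule.subset_span ⟨univ, MeasurableSet.univ, by rw [indicator_univ, E.proj_univ]⟩
  mul_mem p hp q hq := by
    have h := Submodule.mul_mem_mul hp hq
    rw [Submodule.span_mul_span] at h
    refine Submodule.span_mono ?_ h
    rintro _ ⟨_, ⟨A, hA, rfl⟩, _, ⟨B, hB, rfl⟩, rfl⟩
    refine ⟨A ∩ B, hA.inter hB, Prod.ext ?_ (E.proj_mul_proj hA hB)⟩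
    exact (inter_indicator_one).symm
  star_mem p hp := by
    induction hp using Submodule.span_induction with
    | mem p hp =>
      obtain ⟨A, hA, rfl⟩ := hp
      refine Submodule.subset_span ⟨A, hA, Prod.ext ?_ (E.isStarProjection A hA).isSelfAdjoint⟩
      ext t
      by_cases ht : t ∈ A <;> simp [ht]
    | zero => simp
    | add p q _ _ hp hq => rw [star_add]; exact Submodule.add_mem _ hp hq
    | smul c p _ hp => rw [star_smul]; exact Submodule.smul_mem _ _ hp
  bddMeasurable _ hp := (E.span_indicatorGraph_spec hp).1
  inner_eq _ hp := (E.span_indicatorGraph_spec hp).2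
  dense ν _ β hβ ε hε := by
    obtain ⟨g, hg, -⟩ := hβ.exists_simpleFunc_eLpNorm_sub_lt (by norm_num) hε
    obtain ⟨p, hp, hpg⟩ := E.exists_mem_span_indicatorGraph g
    refine ⟨p, hp, ?_⟩
    rw [eLpNorm_sub_comm, hpg]
    exact hg.le

/-- The functional calculus built from `E` returns `E` on indicator functions. -/
theorem op_indicator {A : Set ℝ} (hA : MeasurableSet A) :
    E.spectralCore.op (A.indicator 1) = E.proj A :=
  E.spectralCore.op_eq_of_mem (p := (A.indicator 1, E.proj A))
    (Submodule.subset_span ⟨A, hA, rfl⟩)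

end ProjectionMeasure

namespace SpectralCore

variable {X H : Type*} [MeasurableSpace X] [NormedAddCommGroup H] [InnerProductSpace ℂ H]
  [CompleteSpace H] (C : SpectralCore X H)

/-- The projection-valued measure `A ↦ ∫ 1_{h ∈ A} dE` on `ℝ`, for a measurable real function `h`:
the spectral resolution of the operator that corresponds to `h`. -/
noncomputable def projectionMeasure (h : X → ℝ) (hh : Measurable h) : ProjectionMeasure H where
  proj A := C.op ((h ⁻¹' A).indicator 1)
  isStarProjection A hA := by
    have hb : BddMeasurable ((h ⁻¹' A).indicator (1 : X → ℂ)) := BddMeasurable.one.indicator (hh hA)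
    refine ⟨?_, ?_⟩
    · rw [IsIdempotentElem, ← C.op_mul hb hb, ← inter_indicator_one, inter_self]
    · rw [isSelfAdjoint_iff', ← C.op_star hb]
      congr 1
      ext t
      by_cases ht : t ∈ h ⁻¹' A <;> simp [ht]
  proj_univ := by rw [preimage_univ, indicator_univ, C.op_one]
  hasSum_iUnion A hA hd x := by
    have hbd : ∀ B : Set X, MeasurableSet B → BddMeasurable (B.indicator (1 : X → ℂ)) :=
      fun B hB => BddMeasurable.one.indicator hB
    have hd' : Pairwise (Function.onFun Disjoint fun n => h ⁻¹' A n) :=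
      fun i j hij => (hd hij).preimage h
    rw [preimage_iUnion]
    refine C.hasSum_op (D := 1) (hbd _ (MeasurableSet.iUnion fun n => hh (hA n)))
      (fun n => hbd _ (hh (hA n))) (ae_of_all _ fun t s => ?_) (ae_of_all _ fun t => ?_)
    · rw [← Finset.indicator_biUnion_apply s (fun n => h ⁻¹' A n)
        (fun i _ j _ hij => hd' hij)]
      by_cases h1 : t ∈ ⋃ i ∈ s, h ⁻¹' A i
      · have h2 : t ∈ ⋃ n, h ⁻¹' A n := by
          simp only [mem_iUnion] at h1 ⊢
          exact ⟨_, h1.choose_spec.choose_spec⟩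
        rw [indicator_of_mem h1, indicator_of_mem h2]
        simp
      · rw [indicator_of_notMem h1, sub_zero]
        exact (norm_indicator_le_norm_self _ _).trans (by simp)
    · by_cases ht : t ∈ ⋃ n, h ⁻¹' A n
      · rw [indicator_of_mem ht]
        obtain ⟨n, hn⟩ := mem_iUnion.1 ht
        have := hasSum_single (f := fun k => (h ⁻¹' A k).indicator (1 : X → ℂ) t) n
          fun k hk => indicator_of_notMem (fun hk' => disjoint_left.1 (hd' hk) hk' hn) _
        rwa [indicator_of_mem hn] at this
      · rw [indicator_of_notMem ht]
        have : (fun n => (h ⁻¹' A n).indicator (1 : X → ℂ) t) = fun _ => 0 := by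
          ext n
          exact indicator_of_notMem (fun h' => ht (mem_iUnion.2 ⟨n, h'⟩)) _
        rw [this]
        exact hasSum_zero

theorem projectionMeasure_measure (h : X → ℝ) (hh : Measurable h) (x : H) :
    (C.projectionMeasure h hh).measure x = (C.measure x).map h := by
  ext A hA
  rw [ProjectionMeasure.measure_apply _ _ hA, Measure.map_apply hh hA, C.measure_apply (hh hA),
    ← ofReal_norm, ENNReal.ofReal_pow (norm_nonneg _)]
  rfl

end SpectralCore

/-! ### Spectral measures of a bounded normal operator -/

namespace ContinuousLinearMap

open CompactlySupported

variable {H : Type*} [NormedAddCommGroup H] [InnerProductSpace ℂ H] [CompleteSpace H]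
  {R : H →L[ℂ] H} (hR : IsStarNormal R)

/-- A compactly supported real continuous function as a complex continuous one. -/
def _root_.CompactlySupportedContinuousMap.toComplex {X : Type*} [TopologicalSpace X]
    (f : C_c(X, ℝ)) : C(X, ℂ) := ⟨fun t => (f t : ℂ), by fun_prop⟩

/-- The functional `f ↦ ⟨f(R) x, x⟩` on the real continuous functions on the spectrum of a normal
operator `R`. -/
noncomputable def spectralFunctional (x : H) : C_c(spectrum ℂ R, ℝ) →ₚ[ℝ] ℝ :=
  PositiveLinearMap.mk₀
    { toFun := fun f => (inner ℂ x (cfcHom hR f.toComplex x)).re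
      map_add' := fun f g => by
        have : (f + g).toComplex = f.toComplex + g.toComplex := by
          ext t; simp [CompactlySupportedContinuousMap.toComplex]
        rw [this, map_add, add_apply, inner_add_right, Complex.add_re]
      map_smul' := fun c f => by
        have : (c • f).toComplex = (c : ℂ) • f.toComplex := by
          ext t; simp [CompactlySupportedContinuousMap.toComplex]
        rw [this, map_smul, smul_apply, inner_smul_right, Complex.re_ofReal_mul]
        rfl }
    (fun f hf => by
      let g : C(spectrum ℂ R, ℂ) := ⟨fun t => (Real.sqrt (f t) : ℂ), by fun_prop⟩
      have hg : f.toComplex = star g * g := by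
        ext t
        have : 0 ≤ f t := hf t
        change ((f t : ℝ) : ℂ) = conj (Real.sqrt (f t) : ℂ) * (Real.sqrt (f t) : ℂ)
        rw [Complex.conj_ofReal, ← Complex.ofReal_mul, Real.mul_self_sqrt this]
      change 0 ≤ (inner ℂ x (cfcHom hR f.toComplex x)).re
      rw [hg, map_mul, map_star, star_eq_adjoint]
      change 0 ≤ (inner ℂ x (adjoint (cfcHom hR g) (cfcHom hR g x))).re
      rw [adjoint_inner_right]
      exact inner_self_nonneg (𝕜 := ℂ))

theorem spectralFunctional_apply (x : H) (f : C_c(spectrum ℂ R, ℝ)) :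
    spectralFunctional hR x f = (inner ℂ x (cfcHom hR f.toComplex x)).re := rfl

/-- The form identity for complex continuous functions, by splitting into real and imaginary
part. -/
theorem inner_cfcHom_eq_integral (x : H) (f : C(spectrum ℂ R, ℂ)) :
    inner ℂ x (cfcHom hR f x) = ∫ t, f t ∂(RealRMK.rieszMeasure (spectralFunctional hR x)) := by
  set μ := RealRMK.rieszMeasure (spectralFunctional hR x)
  -- for a real function `g`, the number `⟨g(R) x, x⟩` is real
  have hreal : ∀ g : C_c(spectrum ℂ R, ℝ),
      inner ℂ x (cfcHom hR g.toComplex x) = ((∫ t, g t ∂μ : ℝ) : ℂ) := fun g => by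
    have hsa : star g.toComplex = g.toComplex := by
      ext t; exact Complex.conj_ofReal _
    have h1 : adjoint (cfcHom hR g.toComplex) = cfcHom hR g.toComplex := by
      rw [← star_eq_adjoint, ← map_star, hsa]
    rw [RealRMK.integral_rieszMeasure, spectralFunctional_apply]
    refine (Complex.conj_eq_iff_re.1 ?_).symm
    rw [inner_conj_symm, ← adjoint_inner_right, h1]
  let fr : C_c(spectrum ℂ R, ℝ) :=
    CompactlySupportedContinuousMap.continuousMapEquiv ⟨fun t => (f t).re, by fun_prop⟩
  let fi : C_c(spectrum ℂ R, ℝ) :=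
    CompactlySupportedContinuousMap.continuousMapEquiv ⟨fun t => (f t).im, by fun_prop⟩
  have hf : f = fr.toComplex + Complex.I • fi.toComplex := by
    ext t
    change f t = ((f t).re : ℂ) + Complex.I * ((f t).im : ℂ)
    rw [mul_comm, Complex.re_add_im]
  have hint : Integrable f μ :=
    ((BoundedContinuousFunction.mkOfCompact f).integrable μ :)
  conv_lhs => rw [hf]
  rw [map_add, map_smul, add_apply, smul_apply, inner_add_right, inner_smul_right, hreal, hreal,
    ← integral_re_add_im hint, mul_comm]
  rfl

/-- The continuous functional calculus of a normal operator `R`, with the spectral measures that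
the Riesz–Markov–Kakutani theorem provides. -/
noncomputable def spectralCore : SpectralCore (spectrum ℂ R) H where
  graph := LinearMap.range
    ({ toFun := fun f => (f, cfcHom hR f)
       map_add' := fun f g => by rw [map_add]; rfl
       map_smul' := fun c f => by rw [map_smul]; rfl } :
      C(spectrum ℂ R, ℂ) →ₗ[ℂ] (spectrum ℂ R → ℂ) × (H →L[ℂ] H))
  measure x := RealRMK.rieszMeasure (spectralFunctional hR x)
  isFiniteMeasure _ := inferInstance
  one_mem := ⟨1, Prod.ext rfl (map_one _)⟩
  mul_mem := by
    rintro _ ⟨f, rfl⟩ _ ⟨g, rfl⟩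
    exact ⟨f * g, Prod.ext rfl (map_mul _ _ _)⟩
  star_mem := by
    rintro _ ⟨f, rfl⟩
    exact ⟨star f, Prod.ext rfl (map_star _ _)⟩
  bddMeasurable := by
    rintro _ ⟨f, rfl⟩
    exact ⟨f.continuous.measurable, ‖f‖, f.norm_coe_le_norm⟩
  inner_eq := by
    rintro _ ⟨f, rfl⟩ x
    exact inner_cfcHom_eq_integral hR x f
  dense ν _ β hβ ε hε := by
    obtain ⟨g, hg, -⟩ := hβ.exists_boundedContinuous_eLpNorm_sub_le (by norm_num) hε
    refine ⟨_, ⟨g.toContinuousMap, rfl⟩, ?_⟩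
    rw [eLpNorm_sub_comm]
    exact hg

/-- The identity function corresponds to `R` itself. -/
theorem id_mem_spectralCore :
    ((fun t : spectrum ℂ R => (t : ℂ)), R) ∈ (spectralCore hR).graph :=
  ⟨ContinuousMap.restrict (spectrum ℂ R) (ContinuousMap.id ℂ), Prod.ext rfl (cfcHom_id hR)⟩

end ContinuousLinearMap

/-! ### Positive self-adjoint operators -/

namespace LinearPMap

variable {H : Type*} [NormedAddCommGroup H] [InnerProductSpace ℂ H]
  {Δ : H →ₗ.[ℂ] H}

theorem norm_le_norm_add_apply (hpos : ∀ x : Δ.domain, 0 ≤ (inner ℂ (x : H) (Δ x)).re)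
    (x : Δ.domain) : ‖(x : H)‖ ≤ ‖(x : H) + Δ x‖ := by
  have h1 : ‖(x : H)‖ ^ 2 ≤ ‖(x : H)‖ * ‖(x : H) + Δ x‖ := by
    have h2 : (inner ℂ (x : H) ((x : H) + Δ x)).re =
        ‖(x : H)‖ ^ 2 + (inner ℂ (x : H) (Δ x)).re := by
      rw [inner_add_right, Complex.add_re, inner_self_eq_norm_sq_to_K]
      norm_cast
    have h3 : (inner ℂ (x : H) ((x : H) + Δ x)).re ≤ ‖(x : H)‖ * ‖(x : H) + Δ x‖ :=
      re_inner_le_norm (𝕜 := ℂ) _ _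
    linarith [hpos x]
  rcases (norm_nonneg (x : H)).eq_or_lt with h | h
  · rw [← h]; exact norm_nonneg _
  · rw [pow_two] at h1
    exact le_of_mul_le_mul_left h1 h

variable [CompleteSpace H]

theorem inner_apply_eq_of_isSelfAdjoint (hΔ : IsSelfAdjoint Δ) (x y : Δ.domain) :
    inner ℂ (Δ x) (y : H) = inner ℂ (x : H) (Δ y) := by
  have h := LinearPMap.adjoint_isFormalAdjoint (T := Δ) hΔ.dense_domain
  rw [LinearPMap.isSelfAdjoint_def.1 hΔ] at h
  exact h x y

/-- By the Cauchy–Schwarz inequality for the form `⟨x, Δ y⟩`, a positive self-adjoint operator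
annihilates the null vectors of its form. -/
theorem apply_eq_zero_of_inner_eq_zero (hΔ : IsSelfAdjoint Δ)
    (hpos : ∀ x : Δ.domain, 0 ≤ (inner ℂ (x : H) (Δ x)).re) {z : Δ.domain}
    (hz : inner ℂ (z : H) (Δ z) = 0) : Δ z = 0 := by
  refine hΔ.dense_domain.eq_zero_of_inner_left ℂ fun y hy => ?_
  set w : Δ.domain := ⟨y, hy⟩
  set c : ℂ := inner ℂ (Δ z) y with hc
  have hc' : inner ℂ (z : H) (Δ w) = c := (inner_apply_eq_of_isSelfAdjoint hΔ z w).symm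
  have hc'' : inner ℂ y (Δ z) = conj c := (inner_conj_symm _ _).symm
  set q : ℝ := (inner ℂ y (Δ w)).re with hq
  -- the form at `z - s c̄ y` is `-2 s |c|² + s² |c|² q`, which is negative for small `s` if `c ≠ 0`
  have key : ∀ s : ℝ, 0 ≤ -(2 * s) * ‖c‖ ^ 2 + s ^ 2 * ‖c‖ ^ 2 * q := fun s => by
    have h1 := hpos (z - ((s : ℂ) * conj c) • w)
    have h2 : (inner ℂ ((z - ((s : ℂ) * conj c) • w : Δ.domain) : H)
        (Δ (z - ((s : ℂ) * conj c) • w))).re = -(2 * s) * ‖c‖ ^ 2 + s ^ 2 * ‖c‖ ^ 2 * q := by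
      have h3 : ((z - ((s : ℂ) * conj c) • w : Δ.domain) : H) = z - ((s : ℂ) * conj c) • y := rfl
      rw [h3, LinearPMap.map_sub, LinearPMap.map_smul, inner_sub_left, inner_sub_right,
        inner_sub_right, inner_smul_left, inner_smul_right, inner_smul_left, inner_smul_right, hz,
        hc', hc'', hq]
      rw [← Complex.normSq_eq_norm_sq, Complex.normSq_apply]
      simp
      ring
    rwa [h2] at h1
  by_contra hne
  have hn : 0 < ‖c‖ ^ 2 := by
    have : 0 < ‖c‖ := norm_pos_iff.2 hne
    positivity
  have hq0 : 0 ≤ q := hpos w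
  have h1 := key (1 / (q + 1))
  have h2 : -(2 * (1 / (q + 1))) * ‖c‖ ^ 2 + (1 / (q + 1)) ^ 2 * ‖c‖ ^ 2 * q =
      -(‖c‖ ^ 2 * (q + 2) / (q + 1) ^ 2) := by
    field_simp
    ring
  rw [h2] at h1
  have h3 : 0 < ‖c‖ ^ 2 * (q + 2) / (q + 1) ^ 2 := by positivity
  linarith

/-- A positive self-adjoint operator `Δ` has the bounded resolvent `R = (1 + Δ)⁻¹`. -/
theorem exists_resolvent (hΔ : IsSelfAdjoint Δ)
    (hpos : ∀ x : Δ.domain, 0 ≤ (inner ℂ (x : H) (Δ x)).re) :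
    ∃ R : H →L[ℂ] H, (∀ y, ∃ x : Δ.domain, (x : H) = R y ∧ (x : H) + Δ x = y) ∧
      (∀ x : Δ.domain, R ((x : H) + Δ x) = x) := by
  -- the operator `1 + Δ`, viewed as a bounded operator on the closed graph of `Δ`
  let T : Δ.graph →L[ℂ] H := (ContinuousLinearMap.fst ℂ H H + ContinuousLinearMap.snd ℂ H H).comp
    Δ.graph.subtypeL
  have hcomplete : CompleteSpace Δ.graph := hΔ.isClosed.completeSpace_coe
  have hbound : ∀ p : Δ.graph, ‖p‖ ≤ (2 : NNReal) * ‖T p‖ := by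
    rintro ⟨⟨a, b⟩, hp⟩
    obtain ⟨x, rfl, rfl⟩ := (LinearPMap.mem_graph_iff Δ).1 hp
    have h1 := norm_le_norm_add_apply hpos x
    have h2 : ‖Δ x‖ ≤ ‖(x : H) + Δ x‖ + ‖(x : H)‖ := by
      have := norm_sub_le ((x : H) + Δ x) x
      rwa [add_sub_cancel_left] at this
    change max ‖(x : H)‖ ‖Δ x‖ ≤ 2 * ‖(x : H) + Δ x‖
    refine max_le ?_ ?_ <;> linarith [norm_nonneg ((x : H) + Δ x)]
  have hanti : AntilipschitzWith 2 T := T.antilipschitz_of_bound hbound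
  have hker : T.ker = ⊥ := LinearMap.ker_eq_bot.2 hanti.injective
  have hclosed : _root_.IsClosed (T.range : Set H) := by
    rw [LinearMap.coe_range]
    exact hanti.isClosed_range T.uniformContinuous
  have hrange : T.range = ⊤ := by
    have := hclosed.completeSpace_coe
    rw [← Submodule.orthogonal_eq_bot_iff, Submodule.eq_bot_iff]
    intro y hy
    have h1 : ∀ x : Δ.domain, inner ℂ y ((x : H) + Δ x) = 0 := fun x =>
      Submodule.inner_left_of_mem_orthogonal (K := T.range) ⟨⟨_, Δ.mem_graph x⟩, rfl⟩ hy
    -- a vector orthogonal to the range of `1 + Δ` lies in the domain of the adjoint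
    have h2 : y ∈ Δ.domain := by
      rw [← LinearPMap.isSelfAdjoint_def.1 hΔ]
      refine LinearPMap.mem_adjoint_domain_of_exists _ ⟨-y, fun x => ?_⟩
      have := h1 x
      rw [inner_add_right] at this
      rw [inner_neg_left]
      exact neg_eq_of_add_eq_zero_right this
    have h3 := h1 ⟨y, h2⟩
    have h4 := hpos ⟨y, h2⟩
    rw [inner_add_right] at h3
    have h5 := congrArg Complex.re h3
    have h6 : (inner ℂ y y).re = ‖y‖ ^ 2 := inner_self_eq_norm_sq (𝕜 := ℂ) y
    rw [Complex.add_re, h6, Complex.zero_re] at h5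
    have h7 : ‖y‖ ^ 2 ≤ 0 := by linarith
    simpa using h7
  let e := ContinuousLinearEquiv.ofBijective T hker hrange
  refine ⟨(ContinuousLinearMap.fst ℂ H H).comp
    (Δ.graph.subtypeL.comp (e.symm : H →L[ℂ] Δ.graph)), fun y => ?_, fun x => ?_⟩
  · obtain ⟨x, hx1, hx2⟩ := (LinearPMap.mem_graph_iff Δ).1 (e.symm y).2
    refine ⟨x, hx1, ?_⟩
    rw [hx1, hx2]
    exact e.apply_symm_apply y
  · have : e ⟨_, Δ.mem_graph x⟩ = (x : H) + Δ x := rfl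
    rw [← this]
    simp

/-- The spectrum of a positive contraction is contained in `[0, 1]`. -/
theorem _root_.ContinuousLinearMap.IsPositive.spectrum_subset {R : H →L[ℂ] H} (hR : R.IsPositive)
    (hR1 : ‖R‖ ≤ 1) {t : ℂ} (ht : t ∈ spectrum ℂ R) : (t.re : ℂ) = t ∧ 0 ≤ t.re ∧ t.re ≤ 1 := by
  have h1 : t = t.re := hR.isSelfAdjoint.mem_spectrum_eq_re ht
  have h2 : (0 : H →L[ℂ] H) ≤ R := (ContinuousLinearMap.nonneg_iff_isPositive R).2 hR
  have h3 : t.re ∈ spectrum ℝ R := by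
    rw [← spectrum.algebraMap_mem_iff ℂ]
    change (t.re : ℂ) ∈ _
    rwa [← h1]
  refine ⟨h1.symm, spectrum_nonneg_of_nonneg h2 h3, ?_⟩
  have h4 := spectrum.norm_le_norm_mul_of_mem ht
  have h5 : ‖(1 : H →L[ℂ] H)‖ ≤ 1 := ContinuousLinearMap.norm_id_le
  calc t.re ≤ ‖t‖ := Complex.re_le_norm t
    _ ≤ ‖R‖ * ‖(1 : H →L[ℂ] H)‖ := h4
    _ ≤ 1 := mul_le_one₀ hR1 (norm_nonneg _) h5

end LinearPMap

namespace SpectralCore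

variable {X H : Type*} [MeasurableSpace X] [NormedAddCommGroup H] [InnerProductSpace ℂ H]
  [CompleteSpace H] {C : SpectralCore X H} {R : H →L[ℂ] H} {lam : X → ℝ}

/-- If the operator that corresponds to `λ` is injective, then `{λ = 0}` is a null set of every
spectral measure; so the junk value of `1 / λ` there is harmless. -/
theorem ae_ne_zero_of_injective (hmem : ((fun t => (lam t : ℂ)), R) ∈ C.graph)
    (hinj : ∀ z, R z = 0 → z = 0) (x : H) : ∀ᵐ t ∂(C.measure x), lam t ≠ 0 := by
  have hlam := C.bddMeasurable _ hmem
  have hZ : MeasurableSet {t | lam t = 0} := by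
    have := hlam.measurable (measurableSet_singleton 0)
    simpa [preimage] using this
  have hb := BddMeasurable.one.indicator hZ
  have h0 : (fun t => (lam t : ℂ)) * {t | lam t = 0}.indicator 1 = 0 := by
    ext t
    by_cases ht : lam t = 0 <;> simp [ht]
  have h1 : R (C.op ({t | lam t = 0}.indicator 1) x) = 0 := by
    have h2 := C.op_mul hlam hb
    rw [h0, C.op_eq_of_mem hmem, C.op_zero] at h2
    exact (congrArg (fun T : H →L[ℂ] H => T x) h2).symm
  rw [ae_iff]
  simp only [ne_eq, not_not]
  rw [C.measure_apply hZ, hinj _ h1]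
  simp

/-- If `1 / λ` is square integrable for the spectral measure of `x`, then `x` is in the range of
the operator `R` that corresponds to `λ`. -/
theorem exists_apply_eq_of_lintegral_lt_top (hmem : ((fun t => (lam t : ℂ)), R) ∈ C.graph)
    (hm : Measurable lam) {x : H} (hne : ∀ᵐ t ∂(C.measure x), lam t ≠ 0)
    (hx : ∫⁻ t, ‖(lam t)⁻¹ - 1‖ₑ ^ 2 ∂(C.measure x) < ∞) : ∃ v, R v = x := by
  have h1 : MemLp (fun t => (((lam t)⁻¹ - 1 : ℝ) : ℂ)) 2 (C.measure x) := by
    refine ⟨(Complex.measurable_ofReal.comp (hm.inv.sub_const 1)).aestronglyMeasurable, ?_⟩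
    have h2 : eLpNorm (fun t => (((lam t)⁻¹ - 1 : ℝ) : ℂ)) 2 (C.measure x) ^ 2 < ∞ := by
      rw [eLpNorm_two_sq]
      refine (lintegral_congr fun t => ?_).trans_lt hx
      rw [← ofReal_norm, ← ofReal_norm, Complex.norm_real]
    exact (ENNReal.pow_lt_top_iff.1 h2).resolve_right two_ne_zero
  -- `v` is the vector `∫ 1 / λ dE x`, and `λ · (1 / λ) = 1` almost everywhere
  have h2 := h1.add (BddMeasurable.one.memLp _)
  obtain ⟨v, hv⟩ := exists_represents h2
  refine ⟨v, Represents.unique (BddMeasurable.one.memLp _) ?_ (represents_of_mem C.one_mem x)⟩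
  refine (hv.apply_of_mem h2 hmem).congr_ae ?_
  filter_upwards [hne] with t ht
  change (lam t : ℂ) * ((((lam t)⁻¹ - 1 : ℝ) : ℂ) + 1) = 1
  rw [Complex.ofReal_sub, Complex.ofReal_one, sub_add_cancel, Complex.ofReal_inv,
    mul_inv_cancel₀ (Complex.ofReal_ne_zero.2 ht)]

/-- The spectral measure of `R y` has density `λ²` with respect to the one of `y`. -/
theorem measure_apply_eq_withDensity (hmem : ((fun t => (lam t : ℂ)), R) ∈ C.graph) (y : H) :
    C.measure (R y) = (C.measure y).withDensity fun t => ‖lam t‖ₑ ^ 2 := by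
  have h := C.measure_op (C.bddMeasurable _ hmem) y
  rw [C.op_eq_of_mem hmem] at h
  rw [h]
  refine congrArg _ (funext fun t => ?_)
  rw [← ofReal_norm, ← ofReal_norm, Complex.norm_real]

/-- Vectors in the range of `R` satisfy the domain condition for `1 / λ - 1`, since
`λ (1 / λ - 1) = 1 - λ` is bounded. -/
theorem lintegral_inv_sub_one_lt_top (hmem : ((fun t => (lam t : ℂ)), R) ∈ C.graph)
    (hm : Measurable lam) (h01 : ∀ t, lam t ∈ Icc 0 1) (y : H) :
    ∫⁻ t, ‖(lam t)⁻¹ - 1‖ₑ ^ 2 ∂(C.measure (R y)) < ∞ := by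
  have hdm : Measurable fun t => ‖lam t‖ₑ ^ 2 := hm.enorm.pow_const 2
  rw [measure_apply_eq_withDensity hmem,
    lintegral_withDensity_eq_lintegral_mul _ hdm (by fun_prop)]
  refine lt_of_le_of_lt (lintegral_mono (g := fun _ => 1) fun t => ?_) (by simp)
  obtain ⟨h2, h3⟩ := h01 t
  have h4 : ‖lam t * ((lam t)⁻¹ - 1)‖ ≤ 1 := by
    rw [Real.norm_eq_abs, abs_le, mul_sub, mul_one]
    -- at `λ = 0` the product is `0` by the convention `0⁻¹ = 0`
    rcases h2.eq_or_lt with h0 | h0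
    · simp [← h0]
    · rw [mul_inv_cancel₀ h0.ne']
      constructor <;> linarith
  rw [Pi.mul_apply, ← mul_pow, ← enorm_mul, ← ofReal_norm]
  exact pow_le_one₀ zero_le (ENNReal.ofReal_le_one.2 h4)

/-- With `x = R y` this is the form `⟨x, Δ x⟩ = ⟨x, y - x⟩`, written so that `R` is moved to the
right-hand side. -/
theorem integral_inv_sub_one (hmem : ((fun t => (lam t : ℂ)), R) ∈ C.graph)
    (hm : Measurable lam) {y : H} (hne : ∀ᵐ t ∂(C.measure y), lam t ≠ 0) :
    ∫ t, (((lam t)⁻¹ - 1 : ℝ) : ℂ) ∂(C.measure (R y)) = inner ℂ y (R y - R (R y)) := by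
  have hdm : Measurable fun t => ‖lam t‖ₑ ^ 2 := hm.enorm.pow_const 2
  have hlam := C.bddMeasurable _ hmem
  have h1 := C.inner_op (hlam.sub (hlam.mul hlam)) y
  rw [C.op_sub hlam (hlam.mul hlam), C.op_mul hlam hlam, C.op_eq_of_mem hmem] at h1
  refine Eq.trans ?_ h1.symm
  rw [measure_apply_eq_withDensity hmem, integral_withDensity_eq_integral_toReal_smul hdm
    (ae_of_all _ fun t => by simp)]
  refine integral_congr_ae ?_
  filter_upwards [hne] with t ht
  have h3 : (‖lam t‖ₑ ^ 2).toReal = lam t ^ 2 := by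
    rw [ENNReal.toReal_pow, toReal_enorm, Real.norm_eq_abs, sq_abs]
  have ht' : (lam t : ℂ) ≠ 0 := Complex.ofReal_ne_zero.2 ht
  rw [Complex.real_smul, h3]
  change _ = (lam t : ℂ) - (lam t : ℂ) * lam t
  push_cast
  field_simp

/-- If the bounded operator `R = (1 + Δ)⁻¹` corresponds to a function `λ` with values in `[0, 1]`,
then the image of the spectral measure under `1 / λ - 1` is the spectral resolution of `Δ`. -/
theorem isSpectralResolutionOf_of_resolvent {Δ : H →ₗ.[ℂ] H}
    (hmem : ((fun t => (lam t : ℂ)), R) ∈ C.graph) (hm : Measurable lam)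
    (h01 : ∀ t, lam t ∈ Icc 0 1) (hsym : R.IsSymmetric)
    (hRdom : ∀ y, ∃ x : Δ.domain, (x : H) = R y ∧ (x : H) + Δ x = y)
    (hRinv : ∀ x : Δ.domain, R ((x : H) + Δ x) = x) :
    (C.projectionMeasure (fun t => (lam t)⁻¹ - 1)
      (hm.inv.sub_const 1)).IsSpectralResolutionOf Δ := by
  have hinj : ∀ z, R z = 0 → z = 0 := fun z hz => by
    obtain ⟨x, hx, rfl⟩ := hRdom z
    have : x = 0 := Subtype.ext (by rw [hx, hz]; rfl)
    simp [this]
  have hne := ae_ne_zero_of_injective hmem hinj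
  have hh : Measurable fun t => (lam t)⁻¹ - 1 := hm.inv.sub_const 1
  have hmeas := C.projectionMeasure_measure _ hh
  have hlint : ∀ x, ∫⁻ ξ, ‖ξ‖ₑ ^ 2 ∂((C.projectionMeasure _ hh).measure x) =
      ∫⁻ t, ‖(lam t)⁻¹ - 1‖ₑ ^ 2 ∂(C.measure x) := fun x => by
    rw [hmeas, lintegral_map (by fun_prop) hh]
  refine ⟨?_, fun x => ⟨fun hx => ?_, fun hx => ?_⟩, fun x => ?_⟩
  · ext x
    have h1 := C.measure_apply (hh measurableSet_Iio) x (A := _ ⁻¹' Iio 0)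
    have h2 : C.measure x ((fun t => (lam t)⁻¹ - 1) ⁻¹' Iio 0) = 0 := by
      have : ∀ᵐ t ∂(C.measure x), ¬ (lam t)⁻¹ - 1 < 0 := by
        filter_upwards [hne x] with t ht
        exact not_lt.2 (sub_nonneg.2 ((one_le_inv₀ ((h01 t).1.lt_of_ne' ht)).2 (h01 t).2))
      rw [ae_iff] at this
      simp only [not_not] at this
      exact this
    rw [h2] at h1
    exact enorm_eq_zero.1 (eq_zero_of_pow_eq_zero h1.symm)
  · rw [hlint]
    have := hRinv ⟨x, hx⟩
    rw [show x = R _ from this.symm]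
    exact lintegral_inv_sub_one_lt_top hmem hm h01 _
  · rw [hlint] at hx
    obtain ⟨v, rfl⟩ := exists_apply_eq_of_lintegral_lt_top hmem hm (hne x) hx
    obtain ⟨w, hw, -⟩ := hRdom v
    rw [← hw]
    exact w.2
  · obtain ⟨y, hy⟩ : ∃ y, y = (x : H) + Δ x := ⟨_, rfl⟩
    have hRy : R y = x := by rw [hy, hRinv]
    have hΔx : Δ x = y - R y := by rw [hRy, hy, add_sub_cancel_left]
    rw [hmeas, integral_map hh.aemeasurable (by fun_prop), hΔx, ← hRy,
      integral_inv_sub_one hmem hm (hne y), ← map_sub]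
    exact hsym y (y - R y)

end SpectralCore

namespace LinearPMap

variable {H : Type*} [NormedAddCommGroup H] [InnerProductSpace ℂ H] [CompleteSpace H]
  {Δ : H →ₗ.[ℂ] H}

/-- The spectral theorem for positive self-adjoint operators. -/
theorem exists_isSpectralResolutionOf (hΔ : IsSelfAdjoint Δ)
    (hpos : ∀ x : Δ.domain, 0 ≤ (inner ℂ (x : H) (Δ x)).re) :
    ∃ E : ProjectionMeasure H, E.IsSpectralResolutionOf Δ := by
  obtain ⟨R, hRdom, hRinv⟩ := exists_resolvent hΔ hpos
  have hsym := inner_apply_eq_of_isSelfAdjoint hΔ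
  have hRpos : R.IsPositive := by
    refine ⟨fun y z => ?_, fun y => ?_⟩
    · obtain ⟨x, hx, rfl⟩ := hRdom y
      obtain ⟨w, hw, rfl⟩ := hRdom z
      simp only [coe_coe, ← hx, ← hw, inner_add_left, inner_add_right, hsym]
    · obtain ⟨x, hx, rfl⟩ := hRdom y
      rw [reApplyInnerSelf_apply, ← hx, inner_add_right]
      exact add_nonneg (inner_self_nonneg (𝕜 := ℂ)) (hpos x)
  have hRnorm : ‖R‖ ≤ 1 := by
    refine R.opNorm_le_bound zero_le_one fun y => ?_
    obtain ⟨x, hx, rfl⟩ := hRdom y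
    rw [← hx, one_mul]
    exact norm_le_norm_add_apply hpos x
  have hRn : IsStarNormal R := hRpos.isSelfAdjoint.isStarNormal
  have hspec : ∀ t : spectrum ℂ R, ((t : ℂ).re : ℂ) = t ∧ 0 ≤ (t : ℂ).re ∧ (t : ℂ).re ≤ 1 :=
    fun t => hRpos.spectrum_subset hRnorm t.2
  refine ⟨_, SpectralCore.isSpectralResolutionOf_of_resolvent (C := spectralCore hRn) (R := R)
    (lam := fun t => (t : ℂ).re) ?_ (Complex.measurable_re.comp measurable_subtype_coe)
    (fun t => (hspec t).2) hRpos.isSymmetric hRdom hRinv⟩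
  simp only [hspec]
  exact id_mem_spectralCore hRn

end LinearPMap

/-! ### Dyadic decomposition of vectors -/

namespace ProjectionMeasure

variable {H : Type*} [NormedAddCommGroup H] [InnerProductSpace ℂ H] [CompleteSpace H]
  {E : ProjectionMeasure H}

/-- The range of `β(Δ)` is bandlimited when `β` is supported where `√ξ ≤ ω`. -/
theorem op_mem_rootPaleyWiener {β : ℝ → ℂ} (hβ : BddMeasurable β) {ω : ℝ}
    (hsupp : ∀ ξ, β ξ ≠ 0 → √ξ ≤ ω) (f : H) :
    E.spectralCore.op β f ∈ E.rootPaleyWiener ω := by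
  have hA : MeasurableSet (Real.sqrt ⁻¹' Icc 0 ω) :=
    Real.continuous_sqrt.measurable measurableSet_Icc
  have h1 : (Real.sqrt ⁻¹' Icc 0 ω).indicator 1 * β = β := by
    ext ξ
    by_cases hξ : β ξ = 0
    · simp [hξ]
    · have : ξ ∈ Real.sqrt ⁻¹' Icc 0 ω := ⟨Real.sqrt_nonneg ξ, hsupp ξ hξ⟩
      simp [indicator_of_mem this]
  have h2 := E.spectralCore.op_mul (BddMeasurable.one.indicator hA) hβ
  rw [h1, E.op_indicator hA] at h2
  exact (congrArg (fun T : H →L[ℂ] H => T f) h2).symm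

/-- The spectral measures of an injective positive operator have no mass at `0`. -/
theorem measure_singleton_zero {Δ : H →ₗ.[ℂ] H} (hΔ : IsSelfAdjoint Δ)
    (hpos : ∀ x : Δ.domain, 0 ≤ (inner ℂ (x : H) (Δ x)).re) (hE : E.IsSpectralResolutionOf Δ)
    (hinj : ∀ x : Δ.domain, Δ x = 0 → (x : H) = 0) (f : H) : E.measure f {0} = 0 := by
  set z := E.proj {0} f with hz
  have h0 : MeasurableSet ({0} : Set ℝ) := measurableSet_singleton 0
  have hae : ∀ᵐ ξ ∂(E.measure z), ξ = 0 := by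
    rw [ae_iff]
    change E.measure z {0}ᶜ = 0
    rw [E.measure_apply z h0.compl, hz, ← mul_apply_eq_comp, E.proj_mul_proj h0.compl h0,
      compl_inter_self, E.proj_empty]
    simp
  have hdom : z ∈ Δ.domain := by
    rw [hE.mem_domain_iff, lintegral_congr_ae (g := fun _ => 0)]
    · simp
    · filter_upwards [hae] with ξ hξ
      simp [hξ]
  have hform : inner ℂ z (Δ ⟨z, hdom⟩) = 0 := by
    rw [hE.inner_eq ⟨z, hdom⟩, integral_congr_ae (g := fun _ => 0)]
    · simp
    · filter_upwards [hae] with ξ hξ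
      simp [hξ]
  have hΔz := LinearPMap.apply_eq_zero_of_inner_eq_zero hΔ hpos (z := ⟨z, hdom⟩) hform
  have hz0 : z = 0 := hinj _ hΔz
  rw [E.measure_apply f h0, ← hz, hz0]
  simp

end ProjectionMeasure

namespace IsCalderonPair

variable {φ ψ : ℝ → ℂ}

/-- The half-open intervals `[4^j / 2, 4^(j+1) / 2)`, the dilates of `[1/2, 2)`, tile `[1/2, ∞)`, so
that indicator functions serve as generators. -/
theorem indicator_halfOpen : IsCalderonPair ((Ico 0 (1 / 2)).indicator 1)
    ((Ico (1 / 2) 2).indicator 1) where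
  measurable_low := measurable_one.indicator measurableSet_Ico
  measurable_band := measurable_one.indicator measurableSet_Ico
  support_low := by
    refine support_indicator_subset.trans (Ico_subset_Icc_self.trans (Icc_subset_Icc_right ?_))
    norm_num
  support_band := by
    refine support_indicator_subset.trans (Ico_subset_Icc_self.trans (Icc_subset_Icc ?_ ?_)) <;>
      norm_num
  resolution ξ hξ := by
    have hval (j : ℕ) : dyadicDilate ((Ico (1 / 2) 2).indicator 1) j ξ =
        (Ico ((4 : ℝ) ^ j / 2) (4 ^ (j + 1) / 2)).indicator 1 ξ := by
      have h4 : (2 : ℝ) ^ (2 * j) = 4 ^ j := by rw [pow_mul]; norm_num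
      have hp : (0 : ℝ) < 4 ^ j := by positivity
      have hiff : ξ / 4 ^ j ∈ Ico (1 / 2 : ℝ) 2 ↔ ξ ∈ Ico ((4 : ℝ) ^ j / 2) (4 ^ (j + 1) / 2) := by
        rw [mem_Ico, mem_Ico, le_div_iff₀ hp, div_lt_iff₀ hp, pow_succ]
        constructor <;> rintro ⟨h1, h2⟩ <;> constructor <;> linarith
      rw [dyadicDilate, h4]
      by_cases h : ξ / 4 ^ j ∈ Ico (1 / 2 : ℝ) 2
      · rw [indicator_of_mem h, indicator_of_mem (hiff.1 h)]
        rfl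
      · rw [indicator_of_notMem h, indicator_of_notMem (fun h' => h (hiff.2 h'))]
    simp only [hval]
    by_cases h : ξ < 1 / 2
    · have h1 : ξ ∈ Ico (0 : ℝ) (1 / 2) := ⟨hξ.le, h⟩
      have h2 (j : ℕ) : ξ ∉ Ico ((4 : ℝ) ^ j / 2) (4 ^ (j + 1) / 2) := fun hj => by
        have : (1 : ℝ) ≤ 4 ^ j := one_le_pow₀ (by norm_num)
        linarith [hj.1]
      simp only [indicator_of_mem h1, indicator_of_notMem (h2 _)]
      simp
    · have h1 : ξ ∉ Ico (0 : ℝ) (1 / 2) := fun h' => h h'.2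
      obtain ⟨n, hn1, hn2⟩ := exists_nat_pow_near (x := 2 * ξ) (y := (4 : ℝ))
        (by linarith [not_lt.1 h]) (by norm_num)
      have hn : ξ ∈ Ico ((4 : ℝ) ^ n / 2) (4 ^ (n + 1) / 2) := by
        constructor <;> linarith
      have hk (k : ℕ) (hk : k ≠ n) : ξ ∉ Ico ((4 : ℝ) ^ k / 2) (4 ^ (k + 1) / 2) := fun h' => by
        rcases hk.lt_or_gt with hlt | hlt
        · have : (4 : ℝ) ^ (k + 1) ≤ 4 ^ n := pow_le_pow_right₀ (by norm_num) hlt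
          linarith [h'.2]
        · have : (4 : ℝ) ^ (n + 1) ≤ 4 ^ k := pow_le_pow_right₀ (by norm_num) hlt
          linarith [h'.1]
      have hs := hasSum_single
        (f := fun j => ‖(Ico ((4 : ℝ) ^ j / 2) (4 ^ (j + 1) / 2)).indicator (1 : ℝ → ℂ) ξ‖ ^ 2) n
        fun k hkn => by simp [indicator_of_notMem (hk k hkn)]
      rw [indicator_of_notMem h1]
      simpa [indicator_of_mem hn] using hs

/-- The resolution bounds `φ` by `1` off the origin only; the value at `0` is arbitrary. -/
theorem bddMeasurable_low (h : IsCalderonPair φ ψ) : BddMeasurable φ := by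
  refine ⟨h.measurable_low, max 1 ‖φ 0‖, fun ξ => ?_⟩
  rcases lt_trichotomy ξ 0 with hξ | rfl | hξ
  · have : φ ξ = 0 := by
      by_contra hne
      linarith [(h.support_low hne).1]
    simp [this]
  · exact le_max_right _ _
  · have h1 := (h.resolution ξ hξ).nonneg fun j => by positivity
    exact le_max_of_le_left ((sq_le_one_iff₀ (norm_nonneg _)).1 (by linarith))

theorem bddMeasurable_dyadicDilate (h : IsCalderonPair φ ψ) (j : ℕ) :
    BddMeasurable (dyadicDilate ψ j) := by
  refine ⟨h.measurable_band.comp (measurable_id.div_const _), 1, fun ξ => ?_⟩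
  change ‖ψ (ξ / 2 ^ (2 * j))‖ ≤ 1
  set η := ξ / 2 ^ (2 * j)
  by_cases hη : ψ η = 0
  · simp [hη]
  · have h0 : 0 < η := lt_of_lt_of_le (by norm_num) (h.support_band hη).1
    have h1 := le_hasSum (h.resolution η h0) 0 fun j _ => by positivity
    simp only [dyadicDilate, mul_zero, pow_zero, div_one] at h1
    exact (sq_le_one_iff₀ (norm_nonneg _)).1 (by linarith [sq_nonneg ‖φ η‖])

theorem sqrt_le_of_low (h : IsCalderonPair φ ψ) {ξ : ℝ} (hξ : φ ξ ≠ 0) : √ξ ≤ 1 :=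
  Real.sqrt_le_one.2 (h.support_low hξ).2

theorem sqrt_le_of_dyadicDilate (h : IsCalderonPair φ ψ) {j : ℕ} {ξ : ℝ}
    (hξ : dyadicDilate ψ j ξ ≠ 0) : √ξ ≤ 2 ^ (j + 1) := by
  have h1 := (h.support_band hξ).2
  rw [div_le_iff₀ (by positivity)] at h1
  rw [Real.sqrt_le_left (by positivity)]
  refine h1.trans (le_of_eq ?_)
  ring

theorem dyadicDilate_zero (h : IsCalderonPair φ ψ) (j : ℕ) : dyadicDilate ψ j 0 = 0 := by
  by_contra hne
  have := (h.support_band hne).1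
  norm_num at this

end IsCalderonPair

namespace ProjectionMeasure

variable {H : Type*} [NormedAddCommGroup H] [InnerProductSpace ℂ H] [CompleteSpace H]
  {E : ProjectionMeasure H} {φ ψ : ℝ → ℂ}

/-- The resolution of the identity holds almost everywhere for the spectral measures: they do not
charge `(-∞, 0)`, and at `0` either they have no mass or `|φ(0)| = 1`, the dilates of `ψ` vanishing
there. -/
theorem ae_resolution (h : IsCalderonPair φ ψ) (hneg : E.proj (Iio 0) = 0) {f : H}
    (hzero : E.measure f {0} = 0 ∨ ‖φ 0‖ = 1) :
    ∀ᵐ ξ ∂(E.measure f), HasSum (fun j => ‖dyadicDilate ψ j ξ‖ ^ 2) (1 - ‖φ ξ‖ ^ 2) := by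
  have h1 : ∀ᵐ ξ ∂(E.measure f), 0 ≤ ξ := by
    rw [ae_iff]
    simp only [not_le]
    change E.measure f (Iio 0) = 0
    rw [E.measure_apply f measurableSet_Iio, hneg]
    simp
  have h2 : ∀ᵐ ξ ∂(E.measure f), ξ ≠ 0 ∨ ‖φ 0‖ = 1 := by
    rcases hzero with h0 | h0
    · have : ∀ᵐ ξ ∂(E.measure f), ξ ≠ 0 := by
        rw [ae_iff]
        simpa using h0
      filter_upwards [this] with ξ hξ using Or.inl hξ
    · exact ae_of_all _ fun _ => Or.inr h0
  filter_upwards [h1, h2] with ξ hξ hξ0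
  rcases hξ.eq_or_lt with rfl | hlt
  · rw [hξ0.resolve_left (fun h => h rfl)]
    simp [h.dyadicDilate_zero]
  · exact h.resolution ξ hlt

/-- The operator form of the resolution of the identity `∑ |ψ_j|² = 1 - |φ|²`. -/
theorem hasSum_op_star_mul (h : IsCalderonPair φ ψ) (hneg : E.proj (Iio 0) = 0) {f : H}
    (hzero : E.measure f {0} = 0 ∨ ‖φ 0‖ = 1) :
    HasSum (fun j => E.spectralCore.op (star (dyadicDilate ψ j) * dyadicDilate ψ j) f)
      (f - E.spectralCore.op (star φ * φ) f) := by
  have hφ := h.bddMeasurable_low.star.mul h.bddMeasurable_low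
  have hψ j := (h.bddMeasurable_dyadicDilate j).star.mul (h.bddMeasurable_dyadicDilate j)
  have hsq : ∀ (β : ℝ → ℂ) (ξ : ℝ), (star β * β) ξ = ((‖β ξ‖ ^ 2 : ℝ) : ℂ) := fun β ξ => by
    change conj (β ξ) * β ξ = _
    rw [Complex.conj_mul']
    norm_cast
  have h1 : f - E.spectralCore.op (star φ * φ) f = E.spectralCore.op (1 - star φ * φ) f := by
    rw [E.spectralCore.op_sub BddMeasurable.one hφ, SpectralCore.op_one]
    rfl
  have hval : ∀ ξ, (1 - star φ * φ) ξ = ((1 - ‖φ ξ‖ ^ 2 : ℝ) : ℂ) := fun ξ => by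
    rw [Pi.sub_apply, hsq]
    simp
  have hae := ae_resolution h hneg hzero
  rw [h1]
  refine E.spectralCore.hasSum_op (D := 1) (BddMeasurable.one.sub hφ) hψ ?_ ?_
  · filter_upwards [hae] with ξ hξ s
    simp only [hval, hsq]
    rw [← Complex.ofReal_sum, ← Complex.ofReal_sub, Complex.norm_real, Real.norm_eq_abs, abs_le]
    have h2 : ∑ j ∈ s, ‖dyadicDilate ψ j ξ‖ ^ 2 ≤ 1 - ‖φ ξ‖ ^ 2 :=
      sum_le_hasSum s (fun j _ => by positivity) hξ
    have h3 : 0 ≤ ∑ j ∈ s, ‖dyadicDilate ψ j ξ‖ ^ 2 := Finset.sum_nonneg fun j _ => by positivity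
    constructor <;> linarith [sq_nonneg ‖φ ξ‖]
  · filter_upwards [hae] with ξ hξ
    simp only [hval, hsq]
    exact Complex.hasSum_ofReal.2 hξ

end ProjectionMeasure

theorem mainTheorem4 {H : Type*} [NormedAddCommGroup H] [InnerProductSpace ℂ H] [CompleteSpace H]
    (Δ : H →ₗ.[ℂ] H) (hΔ : IsSelfAdjoint Δ)
    (hpos : ∀ x : Δ.domain, 0 ≤ (inner ℂ (x : H) (Δ x)).re) :
    -- the spectral resolution exists
    (∃ E : ProjectionMeasure H, E.IsSpectralResolutionOf Δ) ∧
    -- real-valued generators exist, with `ψ` even supported in `[1/2, 2]`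
    (∃ φ ψ : ℝ → ℂ, IsCalderonPair φ ψ ∧ Function.support ψ ⊆ Icc (1 / 2) 2 ∧ ‖φ 0‖ = 1 ∧
      (∀ ξ, conj (φ ξ) = φ ξ) ∧ (∀ ξ, conj (ψ ξ) = ψ ξ)) ∧
    -- every pair of generators gives a decomposition of every vector
    (∀ E : ProjectionMeasure H, E.IsSpectralResolutionOf Δ →
      ∀ φ ψ : ℝ → ℂ, IsCalderonPair φ ψ →
        ((∀ x : Δ.domain, Δ x = 0 → (x : H) = 0) ∨ ‖φ 0‖ = 1) →
        ∃ (S : H →L[ℂ] H) (Sj : ℕ → H →L[ℂ] H),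
          E.IsMultiplier φ S ∧
          (∀ j, E.IsMultiplier (dyadicDilate ψ j) (Sj j)) ∧
          (∀ f, S f ∈ E.rootPaleyWiener 1) ∧
          (∀ j f, Sj j f ∈ E.rootPaleyWiener (2 ^ (j + 1))) ∧
          ((∀ ξ, conj (φ ξ) = φ ξ) → IsSelfAdjoint S) ∧
          ((∀ ξ, conj (ψ ξ) = ψ ξ) → ∀ j, IsSelfAdjoint (Sj j)) ∧
          ∀ f : H,
            HasSum (fun j => (Sj j).adjoint (Sj j f)) (f - S.adjoint (S f)) ∧
            ∃ (g : H) (fj : ℕ → H),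
              g = S.adjoint f ∧ (∀ j, fj j = (Sj j).adjoint f) ∧
              g ∈ E.rootPaleyWiener 1 ∧ (∀ j, fj j ∈ E.rootPaleyWiener (2 ^ (j + 1))) ∧
              HasSum (fun j => Sj j (fj j)) (f - S g)) := by
  refine ⟨LinearPMap.exists_isSpectralResolutionOf hΔ hpos,
    ⟨_, _, IsCalderonPair.indicator_halfOpen,
      support_indicator_subset.trans Ico_subset_Icc_self, by simp, fun ξ => ?_, fun ξ => ?_⟩,
    fun E hE φ ψ h hker => ?_⟩
  · by_cases hξ : ξ ∈ Ico (0 : ℝ) (1 / 2)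
    · simp only [indicator_of_mem hξ, Pi.one_apply, map_one]
    · simp only [indicator_of_notMem hξ, map_zero]
  · by_cases hξ : ξ ∈ Ico (1 / 2 : ℝ) 2
    · simp only [indicator_of_mem hξ, Pi.one_apply, map_one]
    · simp only [indicator_of_notMem hξ, map_zero]
  have hφ := h.bddMeasurable_low
  have hψ := h.bddMeasurable_dyadicDilate
  have hzero : ∀ f, E.measure f {0} = 0 ∨ ‖φ 0‖ = 1 := fun f =>
    hker.imp_left fun hinj => ProjectionMeasure.measure_singleton_zero hΔ hpos hE hinj f
  have hadj := fun {β : ℝ → ℂ} (hβ : BddMeasurable β) => E.spectralCore.op_star hβ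
  have hsum := fun f => ProjectionMeasure.hasSum_op_star_mul h hE.proj_neg (hzero f)
  have hstar : ∀ {β : ℝ → ℂ}, BddMeasurable β → ∀ f, E.spectralCore.op (star β * β) f =
      adjoint (E.spectralCore.op β) (E.spectralCore.op β f) := fun hβ f => by
    rw [E.spectralCore.op_mul hβ.star hβ, hadj hβ]
    rfl
  have hstar' : ∀ {β : ℝ → ℂ}, BddMeasurable β → ∀ f, E.spectralCore.op (star β * β) f =
      E.spectralCore.op β (adjoint (E.spectralCore.op β) f) := fun hβ f => by
    rw [mul_comm, E.spectralCore.op_mul hβ hβ.star, hadj hβ]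
    rfl
  refine ⟨E.spectralCore.op φ, fun j => E.spectralCore.op (dyadicDilate ψ j),
    fun x => E.spectralCore.inner_op hφ x, fun j x => E.spectralCore.inner_op (hψ j) x,
    ProjectionMeasure.op_mem_rootPaleyWiener hφ fun ξ hξ => h.sqrt_le_of_low hξ,
    fun j => ProjectionMeasure.op_mem_rootPaleyWiener (hψ j)
      fun ξ hξ => h.sqrt_le_of_dyadicDilate hξ,
    fun hreal => ?_, fun hreal j => ?_, fun f => ⟨?_, _, _, rfl, fun _ => rfl, ?_, fun j => ?_, ?_⟩⟩
  · rw [isSelfAdjoint_iff', ← hadj hφ]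
    exact congrArg _ (funext hreal)
  · rw [isSelfAdjoint_iff', ← hadj (hψ j)]
    exact congrArg _ (funext fun ξ => hreal _)
  · have := hsum f
    rw [hstar hφ] at this
    simpa only [hstar (hψ _)] using this
  · rw [← hadj hφ]
    exact ProjectionMeasure.op_mem_rootPaleyWiener hφ.star
      (fun ξ hξ => h.sqrt_le_of_low fun h0 => hξ (by simp [h0])) f
  · rw [← hadj (hψ j)]
    exact ProjectionMeasure.op_mem_rootPaleyWiener (hψ j).star
      (fun ξ hξ => h.sqrt_le_of_dyadicDilate fun h0 => hξ (by simp [h0])) f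
  · have := hsum f
    rw [hstar' hφ] at this
    simpa only [hstar' (hψ _)] using this
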